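/- All sets are finite. A coherent configuration $\mathcal C$ on a point set $V$ is a partition of $V^2$ into nonempty basis relations such that (A) a basis relation containing a loop $vv$ consists of loops; (B) the transpose of a basis relation is a basis relation; (C) for all $R,S,T\in\mathcal C$ the number $p^T_{RS}=|\{w: uw\in R,\ wv\in S\}|$ is the same for all $uv\in T$. A combinatorial isomorphism from $\mathcal C$ to $\mathcal D$ is a bijection of the point sets that maps basis relations to basis relations; an algebraic isomorphism is a bijection $f:\mathcal C\to\mathcal D$ with $p^T_{RS}=p^{f(T)}_{f(R)f(S)}$ for all $R,S,T$. $\mathcal C$ is separable if every algebraic isomorphism from $\mathcal C$ to any coherent configuration $\mathcal D$ is induced by a combinatorial isomorphism from $\mathcal C$ to $\mathcal D$. A fiber is a set $X\subseteq V$ such that $\{xx: x\in X\}\in\mathcal C$; the fibers partition $V$. For distinct fibers $X,Y$ the interspace $\mathcal C[X,Y]$ is the set of basis relations contained in $X\times Y$; it is uniform if it is $\{X\times Y\}$, and of type $2K_{2,2}$ if $|X|=|Y|=4$ and $\mathcal C[X,Y]$ consists of a relation $(A\times B)\cup((X\setminus A)\times(Y\setminus B))$ with $|A|=|B|=2$ and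 its complement in $X\times Y$; in this case it determines on $Y$ the matching whose two edges are $B$ and $Y\setminus B$. The fiber graph has the fibers as vertices, two fibers being adjacent if the interspace between them is non-uniform. $\mathcal C$ is irredundant if it is not a direct sum (there is no union $U$ of fibers, $\emptyset\ne U\ne V$, with all interspaces between fibers in $U$ and fibers in $V\setminus U$ uniform), all its fibers have size $4$, and every non-uniform interspace is of type $2K_{2,2}$. An irredundant $\mathcal C$ is skew-connected if for any three distinct fibers $X,Y,Z$ with $\mathcal C[X,Y]$ and $\mathcal C[Z,Y]$ non-uniform, these interspaces determine different matchings on $Y$. Theorem. 1. Every coherent configuration with at most $15$ points and maximum fiber size $4$ is separable. 2. There is, up to combinatorial isomorphism, exactly one non-separable coherent configuration with $16$ points and maximum fiber size $4$. It is skew-connected and its fiber graph is isomorphic to the complete graph $K_4$, and every skew-connected coherent configuration whose fiber graph is isomorphic to $K_4$ is combinatorially isomorphic to it. -/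

import Mathlib

universe u v

/-- A rainbow on the point set `V`: a partition of `V × V` into nonempty basis relations such that
a basis relation containing a loop consists of loops, and the transpose of a basis relation is
a basis relation. -/
structure Rainbow (V : Type u) where
  rels : Set (Set (V × V))
  isPartition : Setoid.IsPartition rels
  loops : ∀ R ∈ rels, ∀ x : V, (x, x) ∈ R → ∀ p ∈ R, p.1 = p.2
  transpose : ∀ R ∈ rels, {p : V × V | (p.2, p.1) ∈ R} ∈ rels

/-- The number of points `w` with `(p.1, w) ∈ R` and `(w, p.2) ∈ S`. -/
noncomputable def pathCount {V : Type u} (R S : Set (V × V)) (p : V × V) : ℕ :=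
  {w : V | (p.1, w) ∈ R ∧ (w, p.2) ∈ S}.ncard

/-- A coherent configuration on `V` (used for finite `V`). -/
structure CoherentConfiguration (V : Type u) extends Rainbow V where
  coherent : ∀ R ∈ rels, ∀ S ∈ rels, ∀ T ∈ rels, ∀ p ∈ T, ∀ q ∈ T,
    pathCount R S p = pathCount R S q

namespace CoherentConfiguration

variable {V : Type u} {W : Type v}

theorem rel_nonempty (C : CoherentConfiguration V) (T : C.rels) : (T : Set (V × V)).Nonempty :=
  Setoid.nonempty_of_mem_partition C.isPartition T.2

/-- The intersection number `p_{RS}^T`. -/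
noncomputable def intersectionNumber (C : CoherentConfiguration V) (R S T : C.rels) : ℕ :=
  pathCount (R : Set (V × V)) (S : Set (V × V)) (C.rel_nonempty T).some

theorem pathCount_eq_intersectionNumber (C : CoherentConfiguration V) (R S T : C.rels)
    (p : V × V) (hp : p ∈ (T : Set (V × V))) :
    pathCount (R : Set (V × V)) (S : Set (V × V)) p = C.intersectionNumber R S T :=
  C.coherent R R.2 S S.2 T T.2 p hp _ (C.rel_nonempty T).some_mem

/-- `f` is an algebraic isomorphism from `C` to `D`. -/
def IsAlgebraicIso (C : CoherentConfiguration V) (D : CoherentConfiguration W)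
    (f : C.rels ≃ D.rels) : Prop :=
  ∀ R S T : C.rels,
    C.intersectionNumber R S T = D.intersectionNumber (f R) (f S) (f T)

/-- `φ` is a combinatorial isomorphism from `C` to `D`. -/
def IsCombinatorialIso (C : CoherentConfiguration V) (D : CoherentConfiguration W)
    (φ : V ≃ W) : Prop :=
  ∀ R ∈ C.rels, Prod.map φ φ '' R ∈ D.rels

/-- `C` and `D` are combinatorially isomorphic. -/
def CombinatoriallyIsomorphic (C : CoherentConfiguration V) (D : CoherentConfiguration W) : Prop :=
  ∃ φ : V ≃ W, C.IsCombinatorialIso D φ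

/-- `C` is separable: every algebraic isomorphism from `C` to a coherent configuration `D`
(on a finite point set) is induced by a combinatorial isomorphism from `C` to `D`. -/
def Separable (C : CoherentConfiguration V) : Prop :=
  ∀ (W : Type u) [Finite W] (D : CoherentConfiguration W) (f : C.rels ≃ D.rels),
    C.IsAlgebraicIso D f →
      ∃ φ : V ≃ W, C.IsCombinatorialIso D φ ∧
        ∀ R : C.rels, (f R : Set (W × W)) = Prod.map φ φ '' (R : Set (V × V))

/-- The set of fibers: the sets `X` of points whose set of loops is a basis relation. -/
def fibers (C : CoherentConfiguration V) : Set (Set V) :=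
  {X | {p : V × V | p.1 = p.2 ∧ p.1 ∈ X} ∈ C.rels}

/-- The maximum size of a fiber of `C` is exactly `k`. -/
def HasMaxFiberSize (C : CoherentConfiguration V) (k : ℕ) : Prop :=
  IsGreatest (Set.ncard '' C.fibers) k

/-- `C[X, Y]`, the set of basis relations between the fibers `X` and `Y`. -/
def interspace (C : CoherentConfiguration V) (X Y : Set V) : Set (Set (V × V)) :=
  {R | R ∈ C.rels ∧ R ⊆ X ×ˢ Y}

/-- `C[X, Y]` consists of the single basis relation `X × Y`. -/
def IsUniform (C : CoherentConfiguration V) (X Y : Set V) : Prop :=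
  X ×ˢ Y ∈ C.rels

/-- `C` is not a direct sum of two configurations with nonempty point sets: there is no proper
nonempty union `U` of fibers with all interspaces between `U` and its complement uniform. -/
def Indecomposable (C : CoherentConfiguration V) : Prop :=
  ¬ ∃ F ⊆ C.fibers, (⋃₀ F).Nonempty ∧ (⋃₀ F)ᶜ.Nonempty ∧
    ∀ X ∈ C.fibers, ∀ Y ∈ C.fibers, X ⊆ ⋃₀ F → Y ⊆ (⋃₀ F)ᶜ → C.IsUniform X Y

/-- `C[X, Y]` is of type `2K_{2,2}`, with `{A, X \ A}` and `{B, Y \ B}` the vertex classes of the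
two components of one of its two basis relations. -/
def Is2K22With (C : CoherentConfiguration V) (X Y A B : Set V) : Prop :=
  A ⊆ X ∧ B ⊆ Y ∧ A.ncard = 2 ∧ (X \ A).ncard = 2 ∧ B.ncard = 2 ∧ (Y \ B).ncard = 2 ∧
    C.interspace X Y =
      {A ×ˢ B ∪ (X \ A) ×ˢ (Y \ B), A ×ˢ (Y \ B) ∪ (X \ A) ×ˢ B}

/-- `C[X, Y]` is of type `2K_{2,2}`. -/
def Is2K22 (C : CoherentConfiguration V) (X Y : Set V) : Prop :=
  ∃ A B : Set V, C.Is2K22With X Y A B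

/-- The interspace `C[X, Y]` of type `2K_{2,2}` determines the matching `M` on `Y`: two distinct
points of `Y` are matched if they lie in the same component of a basis relation in `C[X, Y]`. -/
def DeterminesMatching (C : CoherentConfiguration V) (X Y : Set V) (M : Set (V × V)) : Prop :=
  ∃ A B : Set V, C.Is2K22With X Y A B ∧
    M = {p : V × V | p.1 ≠ p.2 ∧ ((p.1 ∈ B ∧ p.2 ∈ B) ∨ (p.1 ∈ Y \ B ∧ p.2 ∈ Y \ B))}

/-- The `2K_{2,2}`-interspaces `C[X, Y]` and `C[Z, Y]` are directly connected at `Y`. -/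
def DirectlyConnectedAt (C : CoherentConfiguration V) (X Z Y : Set V) : Prop :=
  ∃ M : Set (V × V), C.DeterminesMatching X Y M ∧ C.DeterminesMatching Z Y M

/-- `C` is irredundant: it is indecomposable, all fibers have size 4, and all non-uniform
interspaces are of type `2K_{2,2}`. -/
structure Irredundant (C : CoherentConfiguration V) : Prop where
  indecomposable : C.Indecomposable
  fiber_size : ∀ X ∈ C.fibers, X.ncard = 4
  interspace_type : ∀ X ∈ C.fibers, ∀ Y ∈ C.fibers, X ≠ Y → ¬ C.IsUniform X Y → C.Is2K22 X Y

/-- `C` is skew-connected: it is irredundant and no two interspaces `C[X, Y]` and `C[Z, Y]`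
are directly connected. -/
structure SkewConnected (C : CoherentConfiguration V) : Prop where
  irredundant : C.Irredundant
  skewed : ∀ X ∈ C.fibers, ∀ Y ∈ C.fibers, ∀ Z ∈ C.fibers,
    X ≠ Y → Z ≠ Y → X ≠ Z → ¬ C.DirectlyConnectedAt X Z Y

theorem IsUniform.symm {C : CoherentConfiguration V} {X Y : Set V} (h : C.IsUniform X Y) :
    C.IsUniform Y X := by
  have h1 := C.transpose _ h
  have h2 : {p : V × V | (p.2, p.1) ∈ X ×ˢ Y} = Y ×ˢ X := by
    ext p
    simp [and_comm]
  rw [h2] at h1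
  exact h1

/-- The fiber graph of `C`: distinct fibers are adjacent if the interspace between them is
non-uniform. -/
def fiberGraph (C : CoherentConfiguration V) : SimpleGraph C.fibers where
  Adj X Y := X ≠ Y ∧ ¬ C.IsUniform X Y
  symm := ⟨fun _ _ h => ⟨h.1.symm, fun h' => h.2 h'.symm⟩⟩
  loopless := ⟨fun _ h => h.1 rfl⟩

/-- The fiber graph of `C` is isomorphic to the complete graph `K_4`. -/
def FiberGraphIsK4 (C : CoherentConfiguration V) : Prop :=
  Nonempty (C.fiberGraph ≃g (⊤ : SimpleGraph (Fin 4)))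

end CoherentConfiguration

/-! An algebraic isomorphism preserves triangle counts, so corresponding pairs of points have
matching surroundings. What may fail is that the local bijections patch together to a global one.
`Twin` records the local agreement, and `induced_of_color` reduces separability to a colour
preserving map, which is built up fiber by fiber (`Extends`).

If a point of one fiber sees some point of another fiber in a colour of its own, the image of the
second fiber is forced; hence it suffices to treat fibers none of which determines another
(`extends_of_determines`). There every colour class seen in another fiber has at least two points,
so a fiber of at most four points is seen either in one colour or as two pairs. If the partition
depends on the observing point, the interspace is a cycle of length eight. All further fibers see at
most its antipodal pairs, and both fibers of the cycle can be added together (`extends_octagon`). In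
a smallest set of fibers without a map, therefore, all partitions are independent of the observer.
One more fiber can then be added whenever the partitions imposed on it are coarsenings of at most
two of them, because the twin property controls two points at a time (`extends_insert`). The
obstruction thus needs, on every fiber, three distinct partitions coming from three other fibers:
four fibers of four points, that is sixteen points (`isSkewK4_of_not_extends`).

With sixteen points nothing else is left. Fibers and points within a fiber can both be labelled by
the plane over the field with two elements, so that the interspace colour of `(i, a)` and `(j, b)`
is the form of `i + j` and `a + b` (`exists_coordinates`); this gives uniqueness. In this model,
exchanging the two colours in every interspace at one fiber respects triangle counts, since two
observers impose independent linear conditions on a third fiber (`exists_twist_equiv`). No point map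
realises the exchange, because summing over the six pairs of fibers gives a parity contradiction
(`not_exists_twist_map`). -/

/-! ### Twins: pair colourings with equal triangle counts -/

/-- Two pair colourings with a common set of colours which cannot be told apart by counting
triangles: pairs of the same colour admit a bijection of the point sets which respects the colours
of the pairs meeting them. -/
structure Twin {V W ι : Type*} (c : V → V → ι) (d : W → W → ι) : Prop where
  bij : ∀ {x y u v}, c x y = d u v → ∃ e : V ≃ W, ∀ w, d u (e w) = c x w ∧ d (e w) v = c w y
  loop_left : ∀ {x u u'}, c x x = d u u' → u = u'
  loop_right : ∀ {x x' u}, c x x' = d u u → x = x'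
  transp : ∀ {x y u v}, c x y = d u v → c y x = d v u
  surj_left : ∀ x, ∃ u, c x x = d u u
  surj_right : ∀ u, ∃ x, c x x = d u u

namespace Twin

variable {V W Z ι : Type*} {c : V → V → ι} {d : W → W → ι} {b : Z → Z → ι}

theorem symm (h : Twin c d) : Twin d c where
  bij := by
    intro x y u v huv
    obtain ⟨e, he⟩ := h.bij huv.symm
    refine ⟨e.symm, fun w => ?_⟩
    have := he (e.symm w)
    simp only [Equiv.apply_symm_apply] at this
    exact ⟨this.1.symm, this.2.symm⟩
  loop_left := fun e => h.loop_right e.symm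
  loop_right := fun e => h.loop_left e.symm
  transp := fun e => (h.transp e.symm).symm
  surj_left := fun u => (h.surj_right u).imp fun _ e => e.symm
  surj_right := fun u => (h.surj_left u).imp fun _ e => e.symm

/-- The bijection at a pair of equally coloured pairs respects all colours meeting the pair. -/
theorem exists_equiv (h : Twin c d) {x y u v} (huv : c x y = d u v) :
    ∃ e : V ≃ W, e x = u ∧ e y = v ∧ (∀ w, d u (e w) = c x w) ∧ (∀ w, d (e w) u = c w x) ∧
      (∀ w, d v (e w) = c y w) ∧ (∀ w, d (e w) v = c w y) ∧ ∀ w, d (e w) (e w) = c w w := by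
  obtain ⟨e, he⟩ := h.bij huv
  -- `bij` does not speak of the loop at `e w`. A second bijection, at the pair `(x, w)`, sends `w`
  -- to a point whose pair with `e w` has a loop colour, hence to `e w` itself.
  have key : ∀ w, d (e w) (e w) = c w w := by
    intro w
    obtain ⟨e', he'⟩ := h.bij (he w).1.symm
    have h1 := (he' w).2
    rw [← h.loop_left h1.symm] at h1
    rw [← h.loop_left (he' w).2.symm]
    exact h1
  refine ⟨e, (h.loop_left (he x).1.symm).symm, h.loop_left (he y).2.symm,
    fun w => (he w).1, fun w => (h.transp (he w).1.symm).symm,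
    fun w => (h.transp (he w).2.symm).symm, fun w => (he w).2, key⟩

theorem fst_eq (h : Twin c d) {x y u v} (huv : c x y = d u v) : c x x = d u u := by
  obtain ⟨e, rfl, -, -, -, -, -, h7⟩ := h.exists_equiv huv
  exact (h7 x).symm

theorem snd_eq (h : Twin c d) {x y u v} (huv : c x y = d u v) : c y y = d v v :=
  h.fst_eq (h.transp huv)

theorem exists_right (h : Twin c d) {x u} (hu : c x x = d u u) (y : V) :
    ∃ v, c x y = d u v := by
  obtain ⟨e, -, -, h3, -⟩ := h.exists_equiv hu
  exact ⟨e y, (h3 y).symm⟩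

theorem exists_pair (h : Twin c d) (x y : V) : ∃ u v, c x y = d u v := by
  obtain ⟨u, hu⟩ := h.surj_left x
  exact ⟨u, h.exists_right hu y⟩

theorem trans (h : Twin c d) (h' : Twin d b) : Twin c b where
  bij := by
    intro x y u v huv
    obtain ⟨p, q, hpq⟩ := h.exists_pair x y
    obtain ⟨e, he⟩ := h.bij hpq
    obtain ⟨e', he'⟩ := h'.bij (hpq.symm.trans huv)
    refine ⟨e.trans e', fun w => ?_⟩
    simp only [Equiv.trans_apply]
    exact ⟨(he' _).1.trans (he _).1, (he' _).2.trans (he _).2⟩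
  loop_left := by
    intro x u u' hu
    obtain ⟨p, hp⟩ := h.surj_left x
    exact h'.loop_left (hp.symm.trans hu)
  loop_right := by
    intro x x' u hu
    obtain ⟨p, hp⟩ := h'.surj_right u
    exact h.loop_right (hu.trans hp.symm)
  transp := by
    intro x y u v huv
    obtain ⟨p, q, hpq⟩ := h.exists_pair x y
    exact (h.transp hpq).trans (h'.transp (hpq.symm.trans huv))
  surj_left := by
    intro x
    obtain ⟨p, hp⟩ := h.surj_left x
    obtain ⟨q, hq⟩ := h'.surj_left p
    exact ⟨q, hp.trans hq⟩
  surj_right := by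
    intro u
    obtain ⟨p, hp⟩ := h'.surj_right u
    obtain ⟨q, hq⟩ := h.surj_right p
    exact ⟨q, hq.trans hp⟩

theorem left (h : Twin c d) : Twin c c := h.trans h.symm

theorem right (h : Twin c d) : Twin d d := h.symm.trans h

end Twin

/-! ### Basis relations as colours, algebraic isomorphisms as twins -/

namespace CoherentConfiguration

variable {V : Type u} {W : Type v}

/-- The basis relation containing a pair of points. -/
noncomputable def color (C : CoherentConfiguration V) (x y : V) : C.rels :=
  ⟨(C.isPartition.2 (x, y)).choose, (C.isPartition.2 (x, y)).choose_spec.1.1⟩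

theorem mem_color (C : CoherentConfiguration V) (x y : V) : (x, y) ∈ (C.color x y : Set (V × V)) :=
  (C.isPartition.2 (x, y)).choose_spec.1.2

theorem mem_iff_color (C : CoherentConfiguration V) (R : C.rels) (x y : V) :
    (x, y) ∈ (R : Set (V × V)) ↔ C.color x y = R := by
  constructor
  · intro h
    exact Subtype.ext ((C.isPartition.2 (x, y)).choose_spec.2 R ⟨R.2, h⟩).symm
  · rintro rfl
    exact C.mem_color x y

theorem color_loop (C : CoherentConfiguration V) {x y z : V} (h : C.color x x = C.color y z) :
    y = z :=
  C.loops _ (C.color x x).2 x (C.mem_color x x) (y, z) ((C.mem_iff_color _ _ _).2 h.symm)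

theorem color_transp (C : CoherentConfiguration V) {x y u v : V}
    (h : C.color x y = C.color u v) : C.color y x = C.color v u := by
  have h1 : (y, x) ∈ ((⟨_, C.transpose _ (C.color x y).2⟩ : C.rels) : Set (V × V)) :=
    C.mem_color x y
  have h2 : (v, u) ∈ ((⟨_, C.transpose _ (C.color x y).2⟩ : C.rels) : Set (V × V)) := by
    change (u, v) ∈ (C.color x y : Set (V × V))
    exact (C.mem_iff_color _ _ _).2 h.symm
  exact ((C.mem_iff_color _ _ _).1 h1).trans ((C.mem_iff_color _ _ _).1 h2).symm

theorem exists_color (C : CoherentConfiguration V) (R : C.rels) : ∃ x y, C.color x y = R := by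
  obtain ⟨⟨x, y⟩, h⟩ := C.rel_nonempty R
  exact ⟨x, y, (C.mem_iff_color _ _ _).1 h⟩

theorem intersectionNumber_color (C : CoherentConfiguration V) (R S : C.rels) (x y : V) :
    C.intersectionNumber R S (C.color x y) =
      Nat.card {w : V // C.color x w = R ∧ C.color w y = S} := by
  rw [← C.pathCount_eq_intersectionNumber R S _ (x, y) (C.mem_color x y), pathCount,
    ← Nat.card_coe_set_eq]
  simp only [mem_iff_color]
  rfl

/-- An intersection number counts the points `w` lying over one pair of colours. Equal counts give
bijections between these classes, which glue to one bijection of the point sets. That loops go to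
loops and transposes to transposes is not assumed of an algebraic isomorphism; it is extracted from
these bijections. -/
theorem IsAlgebraicIso.twin [Finite V] [Finite W] {C : CoherentConfiguration V}
    {D : CoherentConfiguration W} {f : C.rels ≃ D.rels} (hf : C.IsAlgebraicIso D f) :
    Twin C.color (fun u v => f.symm (D.color u v)) := by
  have bij : ∀ {x y u v}, C.color x y = f.symm (D.color u v) → ∃ e : V ≃ W,
      ∀ w, f.symm (D.color u (e w)) = C.color x w ∧ f.symm (D.color (e w) v) = C.color w y := by
    intro x y u v h
    have key : ∀ p : C.rels × C.rels,
        Nonempty ({w : V // (C.color x w, C.color w y) = p} ≃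
          {w : W // (f.symm (D.color u w), f.symm (D.color w v)) = p}) := by
      rintro ⟨r, s⟩
      have h1 := hf r s (C.color x y)
      rw [C.intersectionNumber_color, h, Equiv.apply_symm_apply, D.intersectionNumber_color] at h1
      simp only [Prod.mk.injEq, Equiv.symm_apply_eq]
      exact ⟨(Finite.card_eq.1 h1).some⟩
    refine ⟨Equiv.ofFiberEquiv fun p => (key p).some, fun w => ?_⟩
    have := Equiv.ofFiberEquiv_map (fun p => (key p).some) w
    simpa only [Prod.mk.injEq] using this
  have left : ∀ {x u u'}, C.color x x = f.symm (D.color u u') → u = u' := by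
    intro x u u' h
    obtain ⟨e, he⟩ := bij h
    obtain ⟨w, rfl⟩ := e.surjective u'
    have h1 := (he w).1
    have h2 := C.color_loop (h.trans h1)
    subst h2
    have h3 := (he x).2
    exact D.color_loop (f.symm.injective (h3.trans h))
  have right : ∀ {x x' u}, C.color x x' = f.symm (D.color u u) → x = x' := by
    intro x x' u h
    obtain ⟨e, he⟩ := bij h
    have h1 := (he x').1
    have h2 := D.color_loop (f.symm.injective (h1.trans h)).symm
    have h3 := (he x').2
    rw [← h2] at h3
    exact C.color_loop (h3.symm.trans h.symm)
  refine ⟨bij, left, right, ?_, ?_, ?_⟩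
  · intro x y u v h
    obtain ⟨e, he⟩ := bij h
    have h1 := (he x).1
    have h2 := left h1.symm
    rw [← h2] at h1
    obtain ⟨e1, he1⟩ := bij h1.symm
    rw [← (he1 y).2]
    have h3 := (he1 y).1.trans h
    rw [D.color_transp (f.symm.injective h3)]
  · intro x
    obtain ⟨u, v, h⟩ := D.exists_color (f (C.color x x))
    have h' : C.color x x = f.symm (D.color u v) := by rw [h, Equiv.symm_apply_apply]
    obtain rfl := left h'
    exact ⟨_, h'⟩
  · intro u
    obtain ⟨x, y, h⟩ := C.exists_color (f.symm (D.color u u))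
    obtain rfl := right h
    exact ⟨_, h⟩

theorem twin_color [Finite V] (C : CoherentConfiguration V) : Twin C.color C.color :=
  IsAlgebraicIso.twin (f := Equiv.refl _) fun _ _ _ => rfl

/-- A colour preserving map between twin configurations induces the algebraic isomorphism. -/
theorem induced_of_color [Finite V] [Finite W] {C : CoherentConfiguration V}
    {D : CoherentConfiguration W} {f : C.rels ≃ D.rels} (hf : C.IsAlgebraicIso D f) (φ : V → W)
    (hφ : ∀ x y, f.symm (D.color (φ x) (φ y)) = C.color x y) :
    ∃ φ : V ≃ W, C.IsCombinatorialIso D φ ∧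
      ∀ R : C.rels, (f R : Set (W × W)) = Prod.map φ φ '' (R : Set (V × V)) := by
  have hinj : Function.Injective φ := by
    intro x y h
    have h1 := hφ x y
    rw [h, hφ y y] at h1
    exact C.color_loop h1
  have key : ∀ (ψ : V ≃ W), (∀ x y, f.symm (D.color (ψ x) (ψ y)) = C.color x y) →
      ∀ R : C.rels, (f R : Set (W × W)) = Prod.map ψ ψ '' (R : Set (V × V)) := by
    intro ψ hψ R
    ext ⟨u, v⟩
    obtain ⟨x, rfl⟩ := ψ.surjective u
    obtain ⟨y, rfl⟩ := ψ.surjective v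
    rw [mem_iff_color, ← Equiv.symm_apply_eq, hψ]
    simp only [Set.mem_image, Prod.exists, Prod.map_apply, Prod.mk.injEq,
      EmbeddingLike.apply_eq_iff_eq]
    constructor
    · intro h
      exact ⟨x, y, (C.mem_iff_color _ _ _).2 h, rfl, rfl⟩
    · rintro ⟨a, b, h, rfl, rfl⟩
      exact (C.mem_iff_color _ _ _).1 h
  have hcard : Nonempty (V ≃ W) := by
    rcases isEmpty_or_nonempty V with hV | ⟨⟨x⟩⟩
    · rcases isEmpty_or_nonempty W with hW | ⟨⟨u⟩⟩
      · exact ⟨Equiv.equivOfIsEmpty V W⟩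
      · obtain ⟨x, -⟩ := hf.twin.surj_right u
        exact (hV.false x).elim
    · obtain ⟨u, hu⟩ := hf.twin.surj_left x
      obtain ⟨e, -⟩ := hf.twin.bij hu
      exact ⟨e⟩
  have hbij : Function.Bijective φ :=
    hinj.bijective_of_nat_card_le (Nat.card_congr hcard.some).ge
  let ψ := Equiv.ofBijective φ hbij
  have hψ := key ψ hφ
  exact ⟨ψ, fun R hR => hψ ⟨R, hR⟩ ▸ (f ⟨R, hR⟩).2, hψ⟩

end CoherentConfiguration

/-! ### Extending partial maps by one fiber -/

/-- There is a colour preserving map on the union of the fibers whose loop colour is in `F`. -/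
def Extends {V W ι : Type*} (c : V → V → ι) (d : W → W → ι) (F : Set ι) : Prop :=
  ∃ φ : V → W, ∀ x y, c x x ∈ F → c y y ∈ F → d (φ x) (φ y) = c x y

/-- Some point of the fiber `i` is the unique point of its colour seen from a point of the
fiber `j`, that is, the fiber `i` determines the fiber `j`. -/
def Determines {V ι : Type*} (c : V → V → ι) (i j : ι) : Prop :=
  ∃ x y, c x x = i ∧ c y y = j ∧ ∀ y', c x y' = c x y → y' = y

namespace Twin

variable {V W ι : Type*} {c : V → V → ι} {d : W → W → ι}

/-- Uniqueness of a point of a given colour is transported between twins. -/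
theorem unique_of_unique (h : Twin c d) {x y u v} (huv : c x y = d u v)
    (hy : ∀ y', c x y' = c x y → y' = y) : ∀ v', d u v' = d u v → v' = v := by
  obtain ⟨e, rfl, rfl, h3, -⟩ := h.exists_equiv huv
  intro v' hv
  obtain ⟨y', rfl⟩ := e.surjective v'
  rw [h3, h3] at hv
  rw [hy y' hv]

theorem determines_refl (h : Twin c c) (x : V) : Determines c (c x x) (c x x) :=
  ⟨x, x, rfl, rfl, fun _ e => (h.loop_left e.symm).symm⟩

theorem determines_exists_at (h : Twin c c) {i j : ι} (hij : Determines c i j) {y : V}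
    (hy : c y y = j) : ∃ x, c x x = i ∧ ∀ y', c x y' = c x y → y' = y := by
  obtain ⟨x0, y0, hx, hy0, huniq⟩ := hij
  obtain ⟨x, hx1⟩ := h.exists_right (hy0.trans hy.symm) x0
  have h1 := h.transp hx1
  exact ⟨x, (h.fst_eq h1).symm.trans hx, h.unique_of_unique h1 huniq⟩

theorem determines_exists_from (h : Twin c c) {i j : ι} (hij : Determines c i j) {x : V}
    (hx : c x x = i) : ∃ y, c y y = j ∧ ∀ y', c x y' = c x y → y' = y := by
  obtain ⟨x0, y0, hx0, hy0, huniq⟩ := hij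
  obtain ⟨y, hy1⟩ := h.exists_right (hx0.trans hx.symm) y0
  exact ⟨y, (h.snd_eq hy1).symm.trans hy0, h.unique_of_unique hy1 huniq⟩

/-- If `x` singles out `y` and `y` singles out `z`, a bijection fixing `x` and moving `z` to `z'`
must fix `y`, and then `z' = z`. -/
theorem determines_trans (h : Twin c c) {i j k : ι} (hij : Determines c i j)
    (hjk : Determines c j k) : Determines c i k := by
  obtain ⟨x, y, hx, hy, hu⟩ := hij
  obtain ⟨z, hz, hu'⟩ := determines_exists_from h hjk hy
  refine ⟨x, z, hx, hz, fun z' hz' => ?_⟩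
  obtain ⟨e, h1, h2, h3, h4, h5, h6, h7⟩ := h.exists_equiv hz'
  apply hu'
  have : e.symm y = y := hu _ (by rw [← h3]; simp)
  have h8 := h5 y
  have h9 : e y = y := ((Equiv.symm_apply_eq e).1 this).symm
  rw [h9] at h8
  exact (h.transp h8).symm

theorem exists_equiv' (h : Twin c d) {x y u v} (huv : c x y = d u v) :
    ∃ e : V ≃ W, e x = u ∧ e y = v ∧ (∀ w, d u (e w) = c x w) ∧ (∀ w, d v (e w) = c y w) := by
  obtain ⟨e, h1, h2, h3, h4, h5, h6, h7⟩ := h.exists_equiv huv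
  exact ⟨e, h1, h2, h3, h5⟩

/-- A partial colour preserving map extends to all fibers determined by its domain. -/
theorem extends_of_determines (h : Twin c d) {F : Set ι}
    (hF : ∀ y, ∃ i ∈ F, Determines c i (c y y)) (hext : Extends c d F) :
    Extends c d Set.univ := by
  obtain ⟨φ, hφ⟩ := hext
  have hp : ∀ y, ∃ x, c x x ∈ F ∧ ∀ y', c x y' = c x y → y' = y := by
    intro y
    obtain ⟨i, hi, hd⟩ := hF y
    obtain ⟨x, rfl, hx⟩ := determines_exists_at h.left hd rfl
    exact ⟨x, hi, hx⟩
  choose p hpF hp using hp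
  have hq : ∀ y, ∃ v, c (p y) y = d (φ (p y)) v := fun y =>
    h.exists_right (hφ _ _ (hpF y) (hpF y)).symm y
  choose ψ hψ using hq
  have huniq : ∀ y v', d (φ (p y)) v' = c (p y) y → v' = ψ y := fun y v' hv =>
    h.unique_of_unique (hψ y) (hp y) v' (hv.trans (hψ y))
  -- The pair `(y, z)` is reached in two moves: the bijection at `(p y, p z)` sends `y` to `ψ y`,
  -- and the one at `(p z, y)` then sends `z` to `ψ z`, both by uniqueness.
  refine ⟨ψ, fun y z _ _ => ?_⟩
  obtain ⟨e, h1, h2, h3, h4⟩ := h.exists_equiv' (hφ _ _ (hpF y) (hpF z)).symm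
  have ey := huniq y _ (h3 y)
  have h5 := h4 y
  rw [ey] at h5
  obtain ⟨e', h1', h2', h3', h4'⟩ := h.exists_equiv' h5.symm
  have ez := huniq z _ (h3' z)
  rw [← ez]
  exact h4' z

open Classical in
/-- Two functions on a finite set with the same values up to order agree at a point if they agree
at all other points. -/
theorem eq_of_map_eq {α β : Type*} {s : Finset α} {f g : α → β}
    (h : s.val.map f = s.val.map g) {a : α} (ha : a ∈ s) (hne : ∀ x ∈ s, x ≠ a → f x = g x) :
    f a = g a := by
  obtain ⟨t, ht, rfl⟩ : ∃ t, a ∉ t ∧ insert a t = s :=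
    ⟨s.erase a, Finset.notMem_erase _ _, Finset.insert_erase ha⟩
  rw [Finset.insert_val_of_notMem ht, Multiset.map_cons, Multiset.map_cons] at h
  have h2 : t.val.map f = t.val.map g := by
    apply Multiset.map_congr rfl
    intro x hx
    exact hne x (Finset.mem_insert_of_mem hx) (fun e => ht (e ▸ hx))
  rw [h2] at h
  exact (Multiset.cons_inj_left _).1 h

/-- If a bijection respects the colours from `y` to all points of the fiber of `y` except
possibly one, then it respects the colour of the remaining pair. -/
theorem eq_of_row [Finite V] (h : Twin c d) {y y' : V} {e : V ≃ W}
    (hy : c y' y' = c y y) (he : ∀ w, d (e w) (e w) = c w w)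
    (hrow : ∀ w, c w w = c y y → w ≠ y' → d (e y) (e w) = c y w) :
    d (e y) (e y') = c y y' := by
  classical
  have := Fintype.ofFinite V
  obtain ⟨e', h1, h2, h3, h4, h5, h6, h7⟩ := h.exists_equiv (he y).symm
  let s : Finset V := Finset.univ.filter fun w => c w w = c y y
  refine eq_of_map_eq (s := s) (f := fun w => d (e y) (e w)) (g := fun w => c y w) ?_
    (by simp [s, hy]) (by simpa [s] using hrow)
  -- The row of `y` becomes the row of `e y` after permuting the fiber by `e'.trans e.symm`, so both
  -- rows have the same multiset of colours.
  have h8 : (fun w => c y w) = fun w => d (e y) (e (e'.trans e.symm w)) := by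
    funext w; simp [h3]
  have h9 : s.val.map (e'.trans e.symm) = s.val := by
    have : s.map (e'.trans e.symm).toEmbedding = s := by
      apply Finset.eq_of_subset_of_card_le
      · intro w hw
        simp only [Finset.mem_map, Equiv.coe_toEmbedding] at hw
        obtain ⟨w', hw', rfl⟩ := hw
        simp only [s, Finset.mem_filter, Finset.mem_univ, true_and] at hw' ⊢
        rw [← he, Equiv.trans_apply, Equiv.apply_symm_apply, h7, hw']
      · simp
    simpa using congrArg Finset.val this
  rw [h8]
  conv_lhs => rw [← h9]
  rw [Multiset.map_map]
  rfl

/-- All fibers have at most four points. -/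
def SmallFibers {V ι : Type*} (c : V → V → ι) : Prop :=
  ∀ x : V, {y | c y y = c x x}.ncard ≤ 4

theorem mem_of_ncard_le_four [Finite V] (hs : SmallFibers c) {x a b p q w : V}
    (ha : c a a = c x x) (hb : c b b = c x x) (hp : c p p = c x x) (hq : c q q = c x x)
    (hab : a ≠ b) (hap : a ≠ p) (haq : a ≠ q) (hbp : b ≠ p) (hbq : b ≠ q) (hpq : p ≠ q)
    (hw : c w w = c x x) : w = a ∨ w = b ∨ w = p ∨ w = q := by
  classical
  by_contra hcon
  push Not at hcon
  have h1 : ({w, a, b, p, q} : Finset V).card = 5 := by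
    rw [Finset.card_insert_of_notMem, Finset.card_insert_of_notMem, Finset.card_insert_of_notMem,
      Finset.card_insert_of_notMem, Finset.card_singleton] <;> simp [*]
  have h2 : (({w, a, b, p, q} : Finset V) : Set V) ⊆ {y | c y y = c x x} := by
    intro y hy
    simp at hy
    rcases hy with rfl | rfl | rfl | rfl | rfl <;> assumption
  have h3 := Set.ncard_le_ncard h2
  rw [Set.ncard_coe_finset, h1] at h3
  have := hs x
  omega

/-- A fiber with at most four points admits a colour preserving map with a prescribed value. -/
theorem exists_fiber_map [Finite V] (h : Twin c d) (hs : SmallFibers c) {y0 : V} {v0 : W}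
    (h0 : c y0 y0 = d v0 v0) : ∃ e : V ≃ W, e y0 = v0 ∧ (∀ w, d (e w) (e w) = c w w) ∧
      ∀ y y', c y y = c y0 y0 → c y' y' = c y0 y0 → d (e y) (e y') = c y y' := by
  by_cases hex : ∃ y1, y1 ≠ y0 ∧ c y1 y1 = c y0 y0
  · obtain ⟨y1, hne, hy1⟩ := hex
    obtain ⟨v1, hv1⟩ := h.exists_right h0 y1
    obtain ⟨e, h1, h2, h3, h4, h5, h6, h7⟩ := h.exists_equiv hv1
    subst h1 h2
    refine ⟨e, rfl, h7, fun y y' hy hy' => ?_⟩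
    by_cases e1 : y = y0
    · subst e1; exact h3 _
    by_cases e2 : y' = y0
    · subst e2; exact h4 _
    by_cases e3 : y = y1
    · subst e3; exact h5 _
    by_cases e4 : y' = y1
    · subst e4; exact h6 _
    by_cases e5 : y = y'
    · subst e5; exact h7 _
    -- Only the pair complementary to `{y0, y1}` remains, and the rest of its row is already
    -- correct.
    refine h.eq_of_row (hy'.trans hy.symm) h7 fun w hw hne' => ?_
    rcases mem_of_ncard_le_four hs rfl hy1 hy hy' hne.symm (Ne.symm e1) (Ne.symm e2) (Ne.symm e3)
      (Ne.symm e4) e5 (hw.trans hy) with rfl | rfl | rfl | rfl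
    · exact h4 _
    · exact h6 _
    · exact h7 _
    · exact (hne' rfl).elim
  · push Not at hex
    obtain ⟨e, h1, h2, h3, h4, h5, h6, h7⟩ := h.exists_equiv h0
    refine ⟨e, h1, h7, fun y y' hy hy' => ?_⟩
    obtain rfl : y = y0 := by by_contra hc; exact hex y hc hy
    obtain rfl : y' = y := by by_contra hc; exact hex y' hc hy'
    exact h7 _

/-- The partition of the fiber `j` into the colour classes seen from a point of the fiber `i`
does not depend on this point. -/
def Block {V ι : Type*} (c : V → V → ι) (i j : ι) : Prop :=
  ∀ x x' y y', c x x = i → c x' x' = i → c y y = j → c y' y' = j → c x y = c x y' →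
    c x' y = c x' y'

/-- A point of the fiber `i` sees at most two colours on the fiber `j`. -/
def AtMostTwo {V ι : Type*} (c : V → V → ι) (i j : ι) : Prop :=
  ∀ x y y' y'', c x x = i → c y y = j → c y' y' = j → c y'' y'' = j → c x y' ≠ c x y →
    c x y'' ≠ c x y → c x y' = c x y''

/-- A map respecting the colours in a fiber `j` and the colours between one of its points and a
point of another fiber respects all colours between this point and the fiber `j`. -/
theorem respects_of_block (h : Twin c d) {x y0 y : V} {u v0 v : W} (hx : c x x = d u u)
    (h0 : d u v0 = c x y0) (hy : c y y = c y0 y0) (hv : d v0 v = c y0 y)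
    (hB : Block c (c x x) (c y0 y0)) (hT : AtMostTwo c (c x x) (c y0 y0)) :
    d u v = c x y := by
  -- Pulling `u` back along `(v0, v)` gives `e u` in the fiber of `x`, seeing `y0` in the same
  -- colour as `x` does. By `Block` both split the fiber alike, and by `AtMostTwo` the colour off
  -- the class of `y0` is unique.
  obtain ⟨e, h1, h2, h3, h4, h5, h6, h7⟩ := h.symm.exists_equiv hv
  subst h1 h2
  have hx' : c (e u) (e u) = c x x := (h7 u).trans hx.symm
  have e0 : c (e u) (e v0) = c x (e v0) := (h4 u).trans h0
  by_cases hc : c x (e v) = c x (e v0)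
  · rw [← h6, hc, ← e0]
    exact hB _ _ _ _ rfl hx' hy rfl hc
  · obtain ⟨w, hw⟩ := h.symm.exists_right hx.symm v
    have hww : c w w = c (e v0) (e v0) := (h.symm.snd_eq hw).symm.trans ((h7 v).symm.trans hy)
    rw [hw]
    apply hT x (e v0) _ _ rfl rfl hww hy _ hc
    rw [← hw, ← h6, ← e0]
    intro hcon
    exact hc (hB _ _ _ _ hx' rfl hy rfl hcon)

/-- The value at a point `y` of a colour preserving map can be chosen if the partitions of the
fiber of `y` seen from the domain all come from at most two points of the domain. -/
theorem exists_value (h : Twin c d) {F : Set ι} {φ : V → W}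
    (hφ : ∀ x y, c x x ∈ F → c y y ∈ F → d (φ x) (φ y) = c x y) {y0 x2 x3 : V}
    (h2 : c x2 x2 ∈ F) (h3 : c x3 x3 ∈ F)
    (hcoarse : ∀ x, c x x ∈ F →
      (∀ y y', c y y = c y0 y0 → c y' y' = c y0 y0 → c x2 y = c x2 y' → c x y = c x y') ∨
      (∀ y y', c y y = c y0 y0 → c y' y' = c y0 y0 → c x3 y = c x3 y' → c x y = c x y')) :
    ∃ v0, c y0 y0 = d v0 v0 ∧ ∀ x, c x x ∈ F → d (φ x) v0 = c x y0 := by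
  -- A bijection at one pair can be made right for two observers at once; every other observer must
  -- inherit the colour from one of these two, which is what `hcoarse` provides.
  obtain ⟨e, e1, e2, e3, e4, e5, e6, e7⟩ := h.exists_equiv (hφ _ _ h2 h3).symm
  refine ⟨e y0, (e7 _).symm, ?_⟩
  have key : ∀ z, c z z ∈ F → d (φ z) (e y0) = c z y0 → ∀ x, c x x ∈ F →
      (∀ y y', c y y = c y0 y0 → c y' y' = c y0 y0 → c z y = c z y' → c x y = c x y') →
      d (φ x) (e y0) = c x y0 := by
    intro z hz hzy x hx hc
    obtain ⟨e', -, -, e3', -, e5', -, e7'⟩ := h.exists_equiv (hφ _ _ hx hz).symm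
    obtain ⟨y', hy'⟩ := e'.surjective (e y0)
    have h6 : c y' y' = c y0 y0 := by rw [← e7', hy', e7]
    rw [← hy', e3']
    apply hc _ _ h6 rfl
    rw [← hzy, ← hy', e5']
  intro x hx
  rcases hcoarse x hx with hc | hc
  · exact key x2 h2 (e3 y0) x hx hc
  · exact key x3 h3 (e5 y0) x hx hc

/-- A colour preserving map extends to a further fiber if a suitable value at one point of this
fiber can be found. -/
theorem extends_insert_of_value [Finite V] (h : Twin c d) (hs : SmallFibers c) {F : Set ι}
    {φ : V → W} (hφ : ∀ x y, c x x ∈ F → c y y ∈ F → d (φ x) (φ y) = c x y) {y0 : V}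
    (hB : ∀ i ∈ F, Block c i (c y0 y0)) (hT : ∀ i ∈ F, AtMostTwo c i (c y0 y0))
    (hv : ∃ v0, c y0 y0 = d v0 v0 ∧ ∀ x, c x x ∈ F → d (φ x) v0 = c x y0) :
    Extends c d (insert (c y0 y0) F) := by
  classical
  obtain ⟨v0, h0, hv⟩ := hv
  obtain ⟨e, rfl, he, hee⟩ := h.exists_fiber_map hs h0
  have key : ∀ x, c x x ∈ F → ∀ y, c y y = c y0 y0 → d (φ x) (e y) = c x y := fun x hx y hy =>
    h.respects_of_block (hφ x x hx hx).symm (hv x hx) hy (hee _ _ rfl hy) (hB _ hx) (hT _ hx)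
  refine ⟨fun x => if c x x = c y0 y0 then e x else φ x, fun x y hx hy => ?_⟩
  dsimp only
  split_ifs with h1 h2 h2
  · exact hee _ _ h1 h2
  · exact (h.transp (key y (hy.resolve_left h2) x h1).symm).symm
  · exact key x (hx.resolve_left h1) y h2
  · exact hφ _ _ (hx.resolve_left h1) (hy.resolve_left h2)

theorem extends_insert [Finite V] (h : Twin c d) (hs : SmallFibers c) {F : Set ι}
    (hF : Extends c d F) {y0 : V}
    (hB : ∀ i ∈ F, Block c i (c y0 y0)) (hT : ∀ i ∈ F, AtMostTwo c i (c y0 y0))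
    (hcoarse : (∀ x, c x x ∉ F) ∨ ∃ x2 x3, c x2 x2 ∈ F ∧ c x3 x3 ∈ F ∧ ∀ x, c x x ∈ F →
      (∀ y y', c y y = c y0 y0 → c y' y' = c y0 y0 → c x2 y = c x2 y' → c x y = c x y') ∨
      (∀ y y', c y y = c y0 y0 → c y' y' = c y0 y0 → c x3 y = c x3 y' → c x y = c x y')) :
    Extends c d (insert (c y0 y0) F) := by
  obtain ⟨φ, hφ⟩ := hF
  refine h.extends_insert_of_value hs hφ hB hT ?_
  rcases hcoarse with hno | ⟨x2, x3, h2, h3, hc⟩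
  · exact (h.surj_left y0).imp fun v hv => ⟨hv, fun x hx => (hno x hx).elim⟩
  · exact h.exists_value hφ h2 h3 hc

end Twin

/-! ### Interspaces between fibers not determining each other; octagons -/

namespace Twin

variable {V W ι : Type*} {c : V → V → ι} {d : W → W → ι}

theorem exists_partner (h : Twin c c) {x y : V} (hij : ¬ Determines c (c x x) (c y y)) :
    ∃ y', c y' y' = c y y ∧ y' ≠ y ∧ c x y' = c x y := by
  by_contra hcon
  push Not at hcon
  refine hij ⟨x, y, rfl, rfl, fun y' hy' => ?_⟩
  by_contra hne
  exact hcon y' (h.snd_eq hy') hne hy'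

/-- Two points of a fiber seen in different colours have different partners of the same colour. -/
theorem exists_halves [Finite V] (h : Twin c c) (hs : SmallFibers c) {x y0 y1 : V}
    (hij : ¬ Determines c (c x x) (c y0 y0)) (hy : c y1 y1 = c y0 y0) (hne : c x y1 ≠ c x y0) :
    ∃ y2 y3, c y2 y2 = c y0 y0 ∧ c y3 y3 = c y0 y0 ∧ c x y2 = c x y0 ∧ c x y3 = c x y1 ∧
      y0 ≠ y1 ∧ y0 ≠ y2 ∧ y0 ≠ y3 ∧ y1 ≠ y2 ∧ y1 ≠ y3 ∧ y2 ≠ y3 ∧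
      ∀ w, c w w = c y0 y0 → w = y0 ∨ w = y1 ∨ w = y2 ∨ w = y3 := by
  obtain ⟨y2, h2, h2', h2''⟩ := h.exists_partner hij
  obtain ⟨y3, h3, h3', h3''⟩ := h.exists_partner (x := x) (y := y1) (by rwa [hy])
  have n01 : y0 ≠ y1 := by rintro rfl; exact hne rfl
  have n03 : y0 ≠ y3 := by rintro rfl; exact hne h3''.symm
  have n12 : y1 ≠ y2 := by rintro rfl; exact hne h2''
  have n23 : y2 ≠ y3 := by rintro rfl; exact hne (h3''.symm.trans h2'')
  exact ⟨y2, y3, h2, h3.trans hy, h2'', h3'', n01, h2'.symm, n03, n12, h3'.symm, n23,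
    fun w hw => mem_of_ncard_le_four hs rfl hy h2 (h3.trans hy) n01 h2'.symm n03 n12 h3'.symm n23
      hw⟩

/-- Each class has at least two points and the fiber at most four. -/
theorem atMostTwo [Finite V] (h : Twin c c) (hs : SmallFibers c) {i j : ι}
    (hij : ¬ Determines c i j) : AtMostTwo c i j := by
  rintro x y y' y'' rfl rfl hy' hy'' hne hne'
  obtain ⟨y2, y3, -, -, e2, e3, -, -, -, -, -, -, hall⟩ := h.exists_halves hs hij hy' hne
  rcases hall y'' hy'' with rfl | rfl | rfl | rfl
  · exact (hne' rfl).elim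
  · rfl
  · exact (hne' e2).elim
  · exact e3.symm

/-- In a nonuniform interspace, no three points have the same colour. -/
theorem not_three [Finite V] (h : Twin c c) (hs : SmallFibers c) {x x' y y' p q t : V}
    (hij : ¬ Determines c (c x x) (c y y)) (hy : c y' y' = c y y) (hne : c x y' ≠ c x y)
    (hx : c x' x' = c x x) (hp : c p p = c y y) (hq : c q q = c y y) (ht : c t t = c y y)
    (hpq : p ≠ q) (hpt : p ≠ t) (hqt : q ≠ t) (e1 : c x' q = c x' p) (e2 : c x' t = c x' p) :
    False := by
  -- If `x'` saw a single colour, so would `x`, against `hne`. Otherwise `x'` sees two classes of at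
  -- least two points among at most four, leaving no room for a class of three.
  by_cases hu : ∀ w, c w w = c y y → c x' w = c x' p
  · obtain ⟨e, h1, h2, h3, h4, h5, h6, h7⟩ := h.exists_equiv hx.symm
    apply hne
    rw [← h3 y', ← h3 y, hu (e y') (by rw [h7, hy]), hu (e y) (h7 y)]
  · push Not at hu
    obtain ⟨w, hw, hwne⟩ := hu
    obtain ⟨y2, y3, -, -, e2', e3', -, -, -, -, -, -, hall⟩ :=
      h.exists_halves hs (x := x') (by rwa [hx, hp]) (hw.trans hp.symm) hwne
    have hq' := hall q (hq.trans hp.symm)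
    have ht' := hall t (ht.trans hp.symm)
    have k1 : q ≠ w := by rintro rfl; exact hwne e1
    have k2 : t ≠ w := by rintro rfl; exact hwne e2
    have k3 : q ≠ y3 := by rintro rfl; exact hwne (e3'.symm.trans e1)
    have k4 : t ≠ y3 := by rintro rfl; exact hwne (e3'.symm.trans e2)
    have k5 : q = y2 := by tauto
    have k6 : t = y2 := by tauto
    exact hqt (k5.trans k6.symm)

/-- The fibers of `y 0` and `z 0` are the two colour classes of a cycle of length eight,
`y p` being adjacent to `z p` and `z (p - 1)`; adjacent pairs have the colour `r`, the other
pairs the colour `s`. -/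
structure IsOctagon {V ι : Type*} (c : V → V → ι) (y z : Fin 4 → V) (r s : ι) : Prop where
  cross : ∀ p q, c (y p) (z q) = if q = p ∨ q + 1 = p then r else s
  ne : r ≠ s
  yinj : Function.Injective y
  zinj : Function.Injective z
  yfib : ∀ p, c (y p) (y p) = c (y 0) (y 0)
  zfib : ∀ p, c (z p) (z p) = c (z 0) (z 0)
  ysurj : ∀ w, c w w = c (y 0) (y 0) → ∃ p, y p = w
  zsurj : ∀ w, c w w = c (z 0) (z 0) → ∃ p, z p = w

theorem IsOctagon.eq_left_iff {y z : Fin 4 → V} {r s : ι} (o : IsOctagon c y z r s)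
    (p q : Fin 4) : c (y p) (z q) = r ↔ q = p ∨ q + 1 = p := by
  rw [o.cross]
  split_ifs with hpq
  · simp [hpq]
  · simp [hpq, o.ne.symm]

/-- Exchanging the two classes requires a shift by one: `z p` is adjacent to `y p` and `y (p + 1)`.
-/
theorem IsOctagon.symm (h : Twin c c) {y z : Fin 4 → V} {r s : ι} (o : IsOctagon c y z r s) :
    IsOctagon c z (fun p => y (p + 1)) (c (z 0) (y 0)) (c (z 0) (y 2)) := by
  have hb : ∀ p, c (y (p + 1)) (y (p + 1)) = c (y (0 + 1)) (y (0 + 1)) := fun p =>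
    (o.yfib _).trans (o.yfib _).symm
  refine ⟨fun p q => ?_, ?_, o.zinj, fun p q hpq => add_right_cancel (o.yinj hpq), o.zfib, hb,
    o.zsurj, fun w hw => ?_⟩
  · have hd : (p = q + 1 ∨ p + 1 = q + 1) ↔ (q = p ∨ q + 1 = p) := by revert p q; decide
    split_ifs with hpq
    · apply h.transp
      rw [o.cross, o.cross, if_pos (hd.2 hpq), if_pos (Or.inl rfl)]
    · apply h.transp
      rw [o.cross, o.cross, if_neg (fun hc => hpq (hd.1 hc)), if_neg (by decide)]
  · intro hc
    have := h.transp hc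
    rw [o.cross, o.cross, if_pos (Or.inl rfl), if_neg (by decide)] at this
    exact o.ne this
  · obtain ⟨p, rfl⟩ := o.ysurj w (hw.trans (o.yfib _))
    exact ⟨p - 1, by simp⟩

/-- Adjacent points of one colour class of an octagon. -/
theorem IsOctagon.adj_eq (h : Twin c c) {y z : Fin 4 → V} {r s : ι} (o : IsOctagon c y z r s)
    {p p' : Fin 4} (hpp : p' = p + 1 ∨ p = p' + 1) : c (y p) (y p') = c (y 0) (y 1) := by
  -- Neighbours in the class share a point `z t`. Moving the edge `(y p, z t)` to `(y 0, z 0)`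
  -- forces `y p'` to go to the other point adjacent to `z 0`, which is `y 1`.
  obtain ⟨t, ht, ht'⟩ : ∃ t, c (y p) (z t) = r ∧ c (y p') (z t) = r := by
    simp only [o.eq_left_iff]
    clear o
    revert p p'; decide
  have hne : p ≠ p' := by clear o ht ht'; revert p p'; decide
  have h0 : c (y p) (z t) = c (y 0) (z 0) := by rw [ht, (o.eq_left_iff 0 0).2 (Or.inl rfl)]
  obtain ⟨e, h1, h2, h3, h4, h5, h6, h7⟩ := h.exists_equiv h0
  obtain ⟨m, hm⟩ := o.ysurj (e (y p')) (by rw [h7, o.yfib])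
  have k1 := h6 (y p')
  rw [← hm, ht', o.eq_left_iff] at k1
  have k2 : m ≠ 0 := by
    rintro rfl
    exact hne (o.yinj (e.injective (by rw [h1, hm])))
  have k3 : m = 1 := by clear hm; revert m; decide
  rw [← h3, ← hm, k3]

/-- Neighbouring points of a class have a common adjacent point in the other class; antipodal points
have none. -/
theorem IsOctagon.anti_ne (h : Twin c c) {y z : Fin 4 → V} {r s : ι} (o : IsOctagon c y z r s)
    (p : Fin 4) : c (y p) (y (p + 2)) ≠ c (y 0) (y 1) := by
  intro hc
  obtain ⟨e, h1, h2, h3, h4, h5, h6, h7⟩ := h.exists_equiv hc.symm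
  obtain ⟨m, hm⟩ := o.zsurj (e (z 0)) (h7 _)
  have k1 := h3 (z 0)
  have k2 := h5 (z 0)
  rw [← hm, (o.eq_left_iff 0 0).2 (Or.inl rfl), o.eq_left_iff] at k1
  rw [← hm, (o.eq_left_iff 1 0).2 (Or.inr rfl), o.eq_left_iff] at k2
  clear hm hc h1 h2 h3 h4 h5 h6
  revert m p; decide

/-- Move `y 0` to `y p`: the image of `y 2` is neither `y p` nor a neighbour of it, so it is the
antipode. -/
theorem IsOctagon.anti_eq (h : Twin c c) {y z : Fin 4 → V} {r s : ι} (o : IsOctagon c y z r s)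
    (p : Fin 4) : c (y p) (y (p + 2)) = c (y 0) (y 2) := by
  obtain ⟨e, h1, h2, h3, h4, h5, h6, h7⟩ := h.exists_equiv (o.yfib p).symm
  obtain ⟨m, hm⟩ := o.ysurj (e (y 2)) (by rw [h7, o.yfib])
  have k0 := h3 (y 2)
  have k1 : m ≠ p := by
    rintro rfl
    have := o.yinj (e.injective (hm.symm.trans h1.symm))
    revert this; decide
  have k2 : m = p + 2 := by
    by_contra hmp
    have : m = p + 1 ∨ p = m + 1 := by
      clear hm k0 h1 h2 h3 h4 h5 h6; revert m p; decide
    rw [← hm, o.adj_eq h this] at k0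
    exact o.anti_ne h 0 k0.symm
  rw [← k0, ← hm, k2]

theorem IsOctagon.antipode (h : Twin c c) {y z : Fin 4 → V} {r s : ι}
    (o : IsOctagon c y z r s) {p q : Fin 4} (hpq : p ≠ q) :
    c (y p) (y q) = if q = p + 2 then c (y 0) (y 2) else c (y 0) (y 1) := by
  split_ifs with hq
  · subst hq; exact o.anti_eq h p
  · apply o.adj_eq h
    clear o; revert p q; decide

/-- Two overlapping incidences that are not part of a rectangle lie on an octagon. -/
theorem exists_octagon [Finite V] (h : Twin c c) (hs : SmallFibers c) {y0 y1 z0 z3 : V}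
    (hy : c y1 y1 = c y0 y0) (hz : c z3 z3 = c z0 z0)
    (hjk : ¬ Determines c (c y0 y0) (c z0 z0)) (hkj : ¬ Determines c (c z0 z0) (c y0 y0))
    (e1 : c y0 z3 = c y0 z0) (e2 : c y1 z0 = c y0 z0) (e3 : c y1 z3 ≠ c y0 z0) :
    ∃ y z s, IsOctagon c y z (c y0 z0) s ∧ y 0 = y0 ∧ y 1 = y1 ∧ z 0 = z0 ∧ z 3 = z3 := by
  have hne1 : c y1 z3 ≠ c y1 z0 := e2 ▸ e3
  have hne2 : c z3 y1 ≠ c z3 y0 := fun hc => e3 ((h.transp hc).trans e1)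
  have hjk' : ¬ Determines c (c y1 y1) (c z0 z0) := by rwa [hy]
  have hkj' : ¬ Determines c (c z3 z3) (c y0 y0) := by rwa [hz]
  obtain ⟨za, zb, fza, fzb, ca, cb, n03, n0a, n0b, n3a, n3b, nab, zall⟩ :=
    h.exists_halves hs hjk' hz hne1
  obtain ⟨ya, yb, fya, fyb, da, db, m01, m0a, m0b, m1a, m1b, mab, yall⟩ :=
    h.exists_halves hs hkj' hy hne2
  have row : ∀ x p q t, c x x = c y0 y0 → c p p = c z0 z0 → c q q = c z0 z0 → c t t = c z0 z0 →
      p ≠ q → p ≠ t → q ≠ t → c x q = c x p → c x t = c x p → False :=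
    fun x p q t hx hp hq ht k1 k2 k3 k4 k5 =>
      h.not_three hs hjk' hz hne1 (hx.trans hy.symm) hp hq ht k1 k2 k3 k4 k5
  have col : ∀ x p q t, c x x = c z0 z0 → c p p = c y0 y0 → c q q = c y0 y0 → c t t = c y0 y0 →
      p ≠ q → p ≠ t → q ≠ t → c q x = c p x → c t x = c p x → False :=
    fun x p q t hx hp hq ht k1 k2 k3 k4 k5 =>
      h.not_three hs hkj' hy hne2 (hx.trans hz.symm) hp hq ht k1 k2 k3 (h.transp k4) (h.transp k5)
  set r := c y0 z0 with hr
  obtain ⟨s, hs'⟩ : ∃ s, c y1 z3 = s := ⟨_, rfl⟩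
  -- The row of `y1` contains only `r` and `s`, hence so does every row. Since `row` and `col`
  -- forbid three equal entries, the whole table of the interspace is then forced.
  have hrs : ∀ x w, c x x = c y0 y0 → c w w = c z0 z0 → c x w ≠ r → c x w = s := by
    intro x w hx hw hne
    obtain ⟨e, h1, h2, h3, h4, h5, h6, h7⟩ := h.exists_equiv (hx.trans hy.symm)
    rw [← h3] at hne ⊢
    rcases zall (e w) (by rw [h7, hw]) with k | k | k | k <;> rw [k] at hne ⊢
    · exact (hne e2).elim
    · exact hs'
    · exact (hne (ca.trans e2)).elim
    · exact cb.trans hs'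
  have hrs' : ∀ x w, c x x = c y0 y0 → c w w = c z0 z0 → c x w ≠ s → c x w = r := by
    intro x w hx hw hne
    by_contra hc
    exact hne (hrs x w hx hw hc)
  have r0a : c y0 za = s := hrs _ _ rfl fza fun hc => row y0 z0 z3 za rfl rfl hz fza n03 n0a n3a e1 hc
  have r0b : c y0 zb = s := hrs _ _ rfl fzb fun hc => row y0 z0 z3 zb rfl rfl hz fzb n03 n0b n3b e1 hc
  have ra0 : c ya z0 = s := hrs _ _ fya rfl fun hc => col z0 y0 y1 ya rfl rfl hy fya m01 m0a m1a e2 hc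
  have rb0 : c yb z0 = s := hrs _ _ fyb rfl fun hc => col z0 y0 y1 yb rfl rfl hy fyb m01 m0b m1b e2 hc
  have ra3 : c ya z3 = r := (h.transp da).trans e1
  have rb3 : c yb z3 = s := (h.transp db).trans hs'
  have rba : c yb za = r := hrs' _ _ fyb fza fun hc =>
    row yb z0 z3 za fyb rfl hz fza n03 n0a n3a (rb3.trans rb0.symm) (hc.trans rb0.symm)
  have rbb : c yb zb = r := hrs' _ _ fyb fzb fun hc =>
    row yb z0 z3 zb fyb rfl hz fzb n03 n0b n3b (rb3.trans rb0.symm) (hc.trans rb0.symm)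
  have r1a : c y1 za = r := ca.trans e2
  have r1b : c y1 zb = s := cb.trans hs'
  have raa : c ya za = s := hrs _ _ fya fza fun hc =>
    col za y1 yb ya fza hy fyb fya m1b m1a mab.symm (rba.trans r1a.symm) (hc.trans r1a.symm)
  have rab : c ya zb = r := hrs' _ _ fya fzb fun hc =>
    row ya z0 za zb fya rfl fza fzb n0a n0b nab (raa.trans ra0.symm) (hc.trans ra0.symm)
  -- The cycle formed by the colour `r` is `y0 z0 y1 za yb zb ya z3`.
  refine ⟨![y0, y1, yb, ya], ![z0, za, zb, z3], s, ⟨?_, fun hc => e3 (hs'.trans hc.symm), ?_, ?_,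
    ?_, ?_, ?_, ?_⟩, rfl, rfl, rfl, rfl⟩
  · intro p q
    fin_cases p <;> fin_cases q <;> simp [*]
  · intro p q
    fin_cases p <;> fin_cases q <;> simp [*, Ne.symm, eq_comm]
  · intro p q
    fin_cases p <;> fin_cases q <;> simp [*, Ne.symm, eq_comm]
  · intro p
    fin_cases p <;> simp [*]
  · intro p
    fin_cases p <;> simp [*]
  · intro w hw
    rcases yall w hw with rfl | rfl | rfl | rfl
    exacts [⟨0, rfl⟩, ⟨1, rfl⟩, ⟨3, rfl⟩, ⟨2, rfl⟩]
  · intro w hw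
    rcases zall w hw with rfl | rfl | rfl | rfl
    exacts [⟨0, rfl⟩, ⟨3, rfl⟩, ⟨1, rfl⟩, ⟨2, rfl⟩]

end Twin

/-! ### Extending a map over an octagon -/

namespace Twin

variable {V W ι : Type*} {c : V → V → ι} {d : W → W → ι}

theorem smallFibers_right [Finite V] [Finite W] (h : Twin c d) (hs : SmallFibers c) :
    SmallFibers d := by
  intro u
  obtain ⟨x, hx⟩ := h.surj_right u
  obtain ⟨e, -, -, -, -, -, -, h7⟩ := h.exists_equiv hx
  have h1 : {v | d v v = d u u} = e '' {y | c y y = c x x} := by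
    ext v
    obtain ⟨y, rfl⟩ := e.surjective v
    simp [h7, hx]
  rw [h1]
  exact (Set.ncard_image_le (Set.toFinite _)).trans (hs x)

theorem determines_of_right (h : Twin c d) {i j : ι} (hd : Determines d i j) :
    Determines c i j := by
  obtain ⟨u, v, rfl, rfl, huv⟩ := hd
  obtain ⟨x, y, hxy⟩ := h.symm.exists_pair u v
  exact ⟨x, y, (h.symm.fst_eq hxy).symm, (h.symm.snd_eq hxy).symm,
    h.symm.unique_of_unique hxy huv⟩

/-- A point outside an octagon does not separate antipodal points of the octagon. -/
theorem IsOctagon.split_of_adj (h : Twin c c) {y z : Fin 4 → V} {r s : ι}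
    (o : IsOctagon c y z r s) {x : V} (hy : ¬ Determines c (c x x) (c (y 0) (y 0)))
    (hz : ¬ Determines c (c x x) (c (z 0) (z 0))) (p : Fin 4)
    (hp : c x (y p) = c x (y (p + 1))) : c x (y p) = c x (y (p + 2)) := by
  by_contra hne
  have h3 : c x (y p) ≠ c x (y (p + 3)) := by
    obtain ⟨w, hw, hwne, hwc⟩ := h.exists_partner (x := x) (y := y (p + 2)) (by rwa [o.yfib])
    obtain ⟨m, rfl⟩ := o.ysurj w (hw.trans (o.yfib _))
    have hm : m = p ∨ m = p + 1 ∨ m = p + 2 ∨ m = p + 3 := by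
      clear hp hne hwne hwc hw; revert m p; decide
    rcases hm with rfl | rfl | rfl | rfl
    · exact (hne hwc).elim
    · exact (hne (hp.trans hwc)).elim
    · exact (hwne rfl).elim
    · rwa [hwc]
  -- The class of `y p` seen from `x` is `{y p, y (p + 1)}`, whose only common adjacent point is `z
  -- p`. Any point of the same colour from `x` as `z p` is also adjacent to both, so `x` singles out
  -- `z p`, contrary to `hz`.
  refine hz ⟨x, z p, rfl, o.zfib p, fun z' hz' => ?_⟩
  obtain ⟨e, h1, h2, e3, -, -, e6, e7⟩ := h.exists_equiv hz'.symm
  have key : ∀ q, q = p ∨ q = p + 1 → ∃ m, y m = e (y q) ∧ (m = p ∨ m = p + 1) ∧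
      c (y m) z' = r := by
    intro q hq
    obtain ⟨m, hm⟩ := o.ysurj (e (y q)) (by rw [e7, o.yfib])
    refine ⟨m, hm, ?_, ?_⟩
    · have hc : c x (y m) = c x (y p) := by
        rw [hm, e3]
        rcases hq with rfl | rfl
        · rfl
        · exact hp.symm
      have hm' : m = p ∨ m = p + 1 ∨ m = p + 2 ∨ m = p + 3 := by
        clear hm hc hp hne h3 hq hz' h2 e6; revert m p; decide
      rcases hm' with rfl | rfl | rfl | rfl
      · exact Or.inl rfl
      · exact Or.inr rfl
      · exact (hne hc.symm).elim
      · exact (h3 hc.symm).elim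
    · rw [hm, e6, o.eq_left_iff]
      clear hm hp hne h3 hz' h2 e6; revert q p; decide
  obtain ⟨q, rfl⟩ := o.zsurj z' ((h.snd_eq hz').trans (o.zfib p))
  obtain ⟨m, hm, hm', hmr⟩ := key p (Or.inl rfl)
  obtain ⟨n, hn, hn', hnr⟩ := key (p + 1) (Or.inr rfl)
  have hmn : m ≠ n := by
    rintro rfl
    have := o.yinj (e.injective (hm.symm.trans hn))
    simp at this
  rw [o.eq_left_iff] at hmr hnr
  congr 1
  clear hm hn key hz' h2 e6 hp hne h3
  revert m n q p; decide

/-- The point `y p` shares its colour with another point of its class of the octagon. Either this is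
the antipode, or it is a neighbour and `split_of_adj` applies. -/
theorem IsOctagon.split (h : Twin c c) {y z : Fin 4 → V} {r s : ι}
    (o : IsOctagon c y z r s) {x : V} (hy : ¬ Determines c (c x x) (c (y 0) (y 0)))
    (hz : ¬ Determines c (c x x) (c (z 0) (z 0))) (p : Fin 4) :
    c x (y p) = c x (y (p + 2)) := by
  have adj := o.split_of_adj h hy hz
  obtain ⟨w, hw, hwne, hwc⟩ := h.exists_partner (x := x) (y := y p) (by rwa [o.yfib])
  obtain ⟨m, rfl⟩ := o.ysurj w (hw.trans (o.yfib _))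
  have hm : m = p ∨ m = p + 1 ∨ m = p + 2 ∨ m = p + 3 := by
    clear adj hwne hwc hw; revert m p; decide
  rcases hm with rfl | rfl | rfl | rfl
  · exact (hwne rfl).elim
  · exact adj p hwc.symm
  · exact hwc.symm
  · have e1 : p + 3 + 1 = p := by clear adj hwne hwc hw; revert p; decide
    have e2 : p + 3 + 2 = p + 1 := by clear adj hwne hwc hw; revert p; decide
    have h1 := adj (p + 3) (by rwa [e1])
    rw [e2] at h1
    exact adj p (hwc.symm.trans h1)

theorem IsOctagon.parity (h : Twin c c) {y z : Fin 4 → V} {r s : ι}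
    (o : IsOctagon c y z r s) {x : V} (hy : ¬ Determines c (c x x) (c (y 0) (y 0)))
    (hz : ¬ Determines c (c x x) (c (z 0) (z 0))) (p : Fin 4) :
    c x (y p) = if p = 0 ∨ p = 2 then c x (y 0) else c x (y 1) := by
  have h0 := o.split h hy hz 0
  have h1 := o.split h hy hz 1
  fin_cases p
  · rfl
  · rfl
  · exact h0.symm
  · exact h1.symm

/-- If a point separates some points of an octagon fiber, its partition is the coarsest possible. -/
theorem IsOctagon.coarse (h : Twin c c) {y z : Fin 4 → V} {r s : ι}
    (o : IsOctagon c y z r s) {x x' : V} (hy : ¬ Determines c (c x x) (c (y 0) (y 0)))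
    (hz : ¬ Determines c (c x x) (c (z 0) (z 0)))
    (hy' : ¬ Determines c (c x' x') (c (y 0) (y 0)))
    (hz' : ¬ Determines c (c x' x') (c (z 0) (z 0)))
    (hne : c x (y 1) ≠ c x (y 0) ∨ c x' (y 1) = c x' (y 0)) (w w' : V)
    (hw : c w w = c (y 0) (y 0)) (hw' : c w' w' = c (y 0) (y 0)) (hc : c x w = c x w') :
    c x' w = c x' w' := by
  obtain ⟨p, rfl⟩ := o.ysurj w hw
  obtain ⟨q, rfl⟩ := o.ysurj w' hw'
  rw [o.parity h hy' hz' p, o.parity h hy' hz' q]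
  rw [o.parity h hy hz p, o.parity h hy hz q] at hc
  split_ifs at hc ⊢ with k1 k2 k2
  · rfl
  · rcases hne with hne | hne
    · exact (hne hc.symm).elim
    · exact hne.symm
  · rcases hne with hne | hne
    · exact (hne hc).elim
    · exact hne
  · rfl

theorem IsOctagon.block (h : Twin c c) {y z : Fin 4 → V} {r s : ι}
    (o : IsOctagon c y z r s) {i : ι} (hy : ¬ Determines c i (c (y 0) (y 0)))
    (hz : ¬ Determines c i (c (z 0) (z 0))) : Block c i (c (y 0) (y 0)) := by
  rintro x x' w w' rfl hx' hw hw' hc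
  by_cases hu : c x (y 1) = c x (y 0)
  · obtain ⟨e, h1, h2, h3, -, -, -, e7⟩ := h.exists_equiv hx'.symm
    have key : ∀ a, c a a = c (y 0) (y 0) → c x' a = c x (y 0) := by
      intro a ha
      obtain ⟨a', rfl⟩ := e.surjective a
      obtain ⟨p, rfl⟩ := o.ysurj a' (by rw [← e7, ha])
      rw [h3, o.parity h hy hz p, hu, ite_self]
    rw [key w hw, key w' hw']
  · exact o.coarse h hy hz (hx' ▸ hy) (hx' ▸ hz) (Or.inl hu) w w' hw hw' hc

/-- All observers in `F` see either one class or the antipodal pairs, so a single observer of the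
finer kind, if there is one, refines all others. -/
theorem IsOctagon.exists_value (h : Twin c d) {y z : Fin 4 → V} {r s : ι}
    (o : IsOctagon c y z r s) {F : Set ι} (hy : ∀ i ∈ F, ¬ Determines c i (c (y 0) (y 0)))
    (hz : ∀ i ∈ F, ¬ Determines c i (c (z 0) (z 0))) {φ : V → W}
    (hφ : ∀ x y, c x x ∈ F → c y y ∈ F → d (φ x) (φ y) = c x y) :
    ∃ v0, c (y 0) (y 0) = d v0 v0 ∧ ∀ x, c x x ∈ F → d (φ x) v0 = c x (y 0) := by
  by_cases hne : ∃ x, c x x ∈ F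
  · obtain ⟨x2, hx2, h2⟩ : ∃ x2, c x2 x2 ∈ F ∧
        (c x2 (y 1) ≠ c x2 (y 0) ∨ ∀ x, c x x ∈ F → c x (y 1) = c x (y 0)) := by
      by_cases hex : ∃ x2, c x2 x2 ∈ F ∧ c x2 (y 1) ≠ c x2 (y 0)
      · obtain ⟨x2, h1, h2⟩ := hex
        exact ⟨x2, h1, Or.inl h2⟩
      · push Not at hex
        obtain ⟨x, hx⟩ := hne
        exact ⟨x, hx, Or.inr hex⟩
    refine Twin.exists_value h hφ hx2 hx2 fun x hx => Or.inl ?_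
    exact o.coarse h.left (hy _ hx2) (hz _ hx2) (hy _ hx) (hz _ hx) (h2.imp_right fun k => k x hx)
  · push Not at hne
    exact (h.surj_left (y 0)).imp fun v hv => ⟨hv, fun x hx => (hne x hx).elim⟩

/-- Within one class of an octagon there are only three colours: of loops, of neighbours and of
antipodes. Agreement on one neighbouring pair and on the row of `y 0` settles everything. -/
theorem IsOctagon.match (h : Twin c d) {y z : Fin 4 → V} {v w : Fin 4 → W} {r s r' s' : ι}
    (o : IsOctagon c y z r s) (o' : IsOctagon d v w r' s') (e : V ≃ W) (e0 : e (y 0) = v 0)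
    (e3 : ∀ a, d (v 0) (e a) = c (y 0) a) (e7 : ∀ a, d (e a) (e a) = c a a)
    (hadj : d (v 0) (v 1) = c (y 0) (y 1)) (p q : Fin 4) : d (v p) (v q) = c (y p) (y q) := by
  by_cases hpq : p = q
  · subst hpq
    rw [o.yfib, o'.yfib, ← e0, e7]
  · rw [o.antipode h.left hpq, o'.antipode h.right hpq, hadj]
    congr 1
    obtain ⟨m, hm⟩ := o'.ysurj (e (y 2)) (by rw [e7, o.yfib, ← e0, e7])
    have hm0 : 0 ≠ m := by
      rintro rfl
      have := o.yinj (e.injective (e0.trans hm))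
      revert this; decide
    have h1 := o'.antipode h.right hm0
    rw [hm, e3, hadj] at h1
    split_ifs at h1
    · exact h1.symm
    · exact (o.anti_ne h.left 0 h1).elim

/-- The image of an octagon in a twin. -/
theorem IsOctagon.exists_image [Finite V] [Finite W] (h : Twin c d) (hs : SmallFibers c)
    {y z : Fin 4 → V} {r s : ι} (o : IsOctagon c y z r s)
    (hyz : ¬ Determines c (c (y 0) (y 0)) (c (z 0) (z 0)))
    (hzy : ¬ Determines c (c (z 0) (z 0)) (c (y 0) (y 0))) {v0 w0 : W}
    (hvw : d v0 w0 = r) : ∃ v w, IsOctagon d v w r s ∧ v 0 = v0 ∧ w 0 = w0 ∧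
      (∀ p q, d (v p) (v q) = c (y p) (y q)) ∧ ∀ p q, d (w p) (w q) = c (z p) (z q) := by
  have h00 : c (y 0) (z 0) = r := (o.eq_left_iff 0 0).2 (Or.inl rfl)
  obtain ⟨e, e1, e2, e3, e4, e5, e6, e7⟩ := h.exists_equiv (h00.trans hvw.symm)
  have hv : d v0 v0 = c (y 0) (y 0) := by rw [← e1, e7]
  have hw : d w0 w0 = c (z 0) (z 0) := by rw [← e2, e7]
  have k1 : d v0 (e (z 3)) = r := (e3 _).trans ((o.eq_left_iff 0 3).2 (Or.inr rfl))
  have k2 : d (e (y 1)) w0 = r := (e6 _).trans ((o.eq_left_iff 1 0).2 (Or.inr rfl))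
  -- The points `y 0` and `y 1` have one common adjacent point, hence so do `v0` and `e (y 1)`. It
  -- is `w0`, so it is not `e (z 3)`.
  have k3 : d (e (y 1)) (e (z 3)) ≠ r := by
    intro hc
    obtain ⟨e', -, -, e3', -, e5', -, e7'⟩ := h.exists_equiv (e3 (y 1)).symm
    have key : ∀ t, d t t = d w0 w0 → d v0 t = r → d (e (y 1)) t = r → t = e' (z 0) := by
      intro t ht ht1 ht2
      obtain ⟨a, rfl⟩ := e'.surjective t
      obtain ⟨q, rfl⟩ := o.zsurj a (by rw [← e7', ht, hw])
      rw [e3', o.eq_left_iff] at ht1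
      rw [e5', o.eq_left_iff] at ht2
      have : q = 0 := by clear * - ht1 ht2; revert q; decide
      rw [this]
    have h1 := key w0 rfl hvw k2
    have h2 := key (e (z 3)) (by rw [e7, o.zfib, hw]) k1 hc
    have h3 := o.zinj (e.injective (e2.trans (h1.trans h2.symm)))
    revert h3; decide
  obtain ⟨v, w, s', o', rfl, hv1, rfl, hw3⟩ := exists_octagon h.right (h.smallFibers_right hs)
    (y0 := v0) (y1 := e (y 1)) (z0 := w0) (z3 := e (z 3))
    (by rw [e7, o.yfib, hv]) (by rw [e7, o.zfib, hw])
    (by rw [hv, hw]; exact fun hd => hyz (h.determines_of_right hd))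
    (by rw [hv, hw]; exact fun hd => hzy (h.determines_of_right hd))
    (k1.trans hvw.symm) (k2.trans hvw.symm) (hvw ▸ k3)
  rw [hvw] at o'
  have hs' : s' = s := by
    have h1 := e3 (z 1)
    rw [o.cross, if_neg (by decide)] at h1
    obtain ⟨m, hm⟩ := o'.zsurj (e (z 1)) (by rw [e7, o.zfib, hw])
    rw [← hm, o'.cross] at h1
    split_ifs at h1
    · exact (o.ne h1).elim
    · exact h1
  subst hs'
  refine ⟨v, w, o', rfl, rfl, o.match h o' e e1 e3 e7 (by rw [hv1, e3]), ?_⟩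
  -- The known correspondence is that of `z 3` and `w 3`; as index `3` is a neighbour of `0`, its
  -- colour equals the one required at index `1`.
  refine (o.symm h.left).match h (o'.symm h.right) e e2 e5 e7 ?_
  have h1 := (o.symm h.left).antipode h.left (p := 0) (q := 3) (by decide)
  have h2 := (o'.symm h.right).antipode h.right (p := 0) (q := 3) (by decide)
  rw [if_neg (by decide)] at h1 h2
  rw [← h1, ← h2, hw3, e5]

/-- A colour preserving map extends to two fibers joined by an octagon. -/
theorem extends_octagon [Finite V] [Finite W] (h : Twin c d) (hs : SmallFibers c)
    {y z : Fin 4 → V} {r s : ι} (o : IsOctagon c y z r s)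
    (hyz : ¬ Determines c (c (y 0) (y 0)) (c (z 0) (z 0)))
    (hzy : ¬ Determines c (c (z 0) (z 0)) (c (y 0) (y 0))) {F : Set ι}
    (hy : ∀ i ∈ F, ¬ Determines c i (c (y 0) (y 0)))
    (hz : ∀ i ∈ F, ¬ Determines c i (c (z 0) (z 0))) (hF : Extends c d F) :
    Extends c d (insert (c (y 0) (y 0)) (insert (c (z 0) (z 0)) F)) := by
  classical
  obtain ⟨φ, hφ⟩ := hF
  have osymm := o.symm h.left
  have hz1 : ∀ i ∈ F, ¬ Determines c i (c (y (0 + 1)) (y (0 + 1))) := fun i hi => by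
    rw [o.yfib]; exact hy i hi
  obtain ⟨v1, hv1, hv1'⟩ := o.exists_value h hy hz hφ
  obtain ⟨w0, hw0, hw0'⟩ := osymm.exists_value h hz hz1 hφ
  have respY : ∀ v0, c (y 0) (y 0) = d v0 v0 → (∀ x, c x x ∈ F → d (φ x) v0 = c x (y 0)) →
      ∀ p v, d v0 v = c (y 0) (y p) → ∀ x, c x x ∈ F → d (φ x) v = c x (y p) :=
    fun v0 h0 hv0 p v hv x hx => h.respects_of_block (hφ x x hx hx).symm (hv0 x hx) (o.yfib p) hv
      (o.block h.left (hy _ hx) (hz _ hx)) (atMostTwo h.left hs (hy _ hx))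
  have respZ : ∀ p w, d w0 w = c (z 0) (z p) → ∀ x, c x x ∈ F → d (φ x) w = c x (z p) :=
    fun p w hw x hx => h.respects_of_block (hφ x x hx hx).symm (hw0' x hx) (o.zfib p) hw
      (osymm.block h.left (hz _ hx) (hz1 _ hx)) (atMostTwo h.left hs (hz _ hx))
  -- The values `v1` and `w0` were found separately and need not be adjacent. Each point of one
  -- class is adjacent to exactly one of two antipodes of the other, and replacing `v1` by its
  -- antipode `v2` is invisible from `F`.
  obtain ⟨v0, hv0, hv0', hvw⟩ : ∃ v0, c (y 0) (y 0) = d v0 v0 ∧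
      (∀ x, c x x ∈ F → d (φ x) v0 = c x (y 0)) ∧ d v0 w0 = r := by
    obtain ⟨v2, hv2⟩ := h.exists_right hv1 (y 2)
    obtain ⟨e, e1, e2, e3, e4, e5, e6, e7⟩ := h.exists_equiv hv2
    obtain ⟨a, rfl⟩ := e.surjective w0
    obtain ⟨q, rfl⟩ := o.zsurj a (by rw [← e7, hw0])
    by_cases hq : d v1 (e (z q)) = r
    · exact ⟨v1, hv1, hv1', hq⟩
    · refine ⟨v2, ?_, fun x hx => ?_, ?_⟩
      · rw [← h.snd_eq hv2]; exact (o.yfib 2).symm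
      · rw [respY v1 hv1 hv1' 2 v2 hv2.symm x hx]
        exact (o.split h.left (hy _ hx) (hz _ hx) 0).symm
      · rw [e3, o.eq_left_iff] at hq
        rw [e5, o.eq_left_iff]
        clear hw0 hw0' respZ
        revert q; decide
  obtain ⟨v, w, o', rfl, rfl, hvv, hww⟩ := o.exists_image h hs hyz hzy hvw
  have FY : ∀ x, c x x ∈ F → ∀ p, d (φ x) (v p) = c x (y p) := fun x hx p =>
    respY _ hv0 hv0' p _ (hvv 0 p) x hx
  have FZ : ∀ x, c x x ∈ F → ∀ p, d (φ x) (w p) = c x (z p) := fun x hx p =>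
    respZ p _ (hww 0 p) x hx
  have YZ : ∀ p q, d (v p) (w q) = c (y p) (z q) := fun p q => by rw [o.cross, o'.cross]
  have hne : c (z 0) (z 0) ≠ c (y 0) (y 0) := by
    intro hc
    rw [hc] at hyz
    exact hyz (h.left.determines_refl _)
  have hP : ∀ p, Function.invFun y (y p) = p := Function.leftInverse_invFun o.yinj
  have hQ : ∀ p, Function.invFun z (z p) = p := Function.leftInverse_invFun o.zinj
  let ψ : V → W := fun a => if c a a = c (y 0) (y 0) then v (Function.invFun y a)
    else if c a a = c (z 0) (z 0) then w (Function.invFun z a) else φ a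
  have ψy : ∀ p, ψ (y p) = v p := fun p => by simp only [ψ, if_pos (o.yfib p), hP]
  have ψz : ∀ p, ψ (z p) = w p := fun p => by
    simp only [ψ, o.zfib p, if_neg hne, hQ, if_true]
  have hcases : ∀ a, c a a ∈ insert (c (y 0) (y 0)) (insert (c (z 0) (z 0)) F) →
      (∃ p, y p = a) ∨ (∃ p, z p = a) ∨ (c a a ∈ F ∧ ψ a = φ a) := by
    intro a ha
    by_cases h1 : c a a = c (y 0) (y 0)
    · exact Or.inl (o.ysurj a h1)
    by_cases h2 : c a a = c (z 0) (z 0)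
    · exact Or.inr (Or.inl (o.zsurj a h2))
    · exact Or.inr (Or.inr ⟨(ha.resolve_left h1).resolve_left h2, by simp only [ψ, if_neg h1, if_neg h2]⟩)
  have tr : ∀ {u u' a a'}, d u u' = c a a' → d u' u = c a' a := fun e => (h.transp e.symm).symm
  refine ⟨ψ, fun a a' ha ha' => ?_⟩
  rcases hcases a ha with ⟨p, rfl⟩ | ⟨p, rfl⟩ | ⟨ha, e1⟩ <;>
    rcases hcases a' ha' with ⟨q, rfl⟩ | ⟨q, rfl⟩ | ⟨ha', e2⟩
  · rw [ψy, ψy, hvv]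
  · rw [ψy, ψz, YZ]
  · rw [ψy, e2]; exact tr (FY _ ha' p)
  · rw [ψy, ψz]; exact tr (YZ _ _)
  · rw [ψz, ψz, hww]
  · rw [ψz, e2]; exact tr (FZ _ ha' p)
  · rw [e1, ψy]; exact FY _ ha q
  · rw [e1, ψz]; exact FZ _ ha q
  · rw [e1, e2]; exact hφ _ _ ha ha'

end Twin

/-! ### The smallest obstruction: four pairwise skew fibers -/

namespace Twin

/-- There are four fibers of size four, any two of which are joined by an interspace of type
`2K_{2,2}`, and different interspaces at a fiber determine different matchings. -/
structure IsSkewK4 {V ι : Type*} (c : V → V → ι) : Prop where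
  card_fibers : {i | ∃ x, c x x = i}.ncard = 4
  block : ∀ x y, c x x ≠ c y y → Block c (c x x) (c y y)
  halves : ∀ x y, c x x ≠ c y y → ∃ y1 y2 y3, c y1 y1 = c y y ∧ c y2 y2 = c y y ∧
    c y3 y3 = c y y ∧ c x y1 = c x y ∧ c x y3 = c x y2 ∧ c x y2 ≠ c x y ∧
    y ≠ y1 ∧ y ≠ y2 ∧ y ≠ y3 ∧ y1 ≠ y2 ∧ y1 ≠ y3 ∧ y2 ≠ y3 ∧
    ∀ w, c w w = c y y → w = y ∨ w = y1 ∨ w = y2 ∨ w = y3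
  skew : ∀ x x' y y', c x x ≠ c y y → c x' x' ≠ c y y → c x x ≠ c x' x' → c y' y' = c y y →
    y' ≠ y → c x y' = c x y → c x' y' ≠ c x' y

variable {V W ι : Type*} {c : V → V → ι} {d : W → W → ι}

/-- Every fiber is determined by a member of a set of fibers not determining each other. -/
theorem exists_basis [Finite V] (h : Twin c c) : ∃ B : Finset ι,
    (∀ y, ∃ i ∈ B, Determines c i (c y y)) ∧ ∀ i ∈ B, ∀ j ∈ B, i ≠ j → ¬ Determines c i j := by
  classical
  have := Fintype.ofFinite V
  obtain ⟨B, hB, hmin⟩ := exists_minimal_of_wellFoundedLT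
    (fun B : Finset ι => ∀ y, ∃ i ∈ B, Determines c i (c y y))
    ⟨Finset.univ.image fun x => c x x, fun y => ⟨c y y, by simp, h.determines_refl y⟩⟩
  refine ⟨B, hB, fun i hi j hj hij hd => ?_⟩
  have h1 : B ≤ B.erase j := by
    apply hmin _ (Finset.erase_subset _ _)
    intro y
    obtain ⟨k, hk, hky⟩ := hB y
    by_cases hkj : k = j
    · subst hkj
      exact ⟨i, Finset.mem_erase.2 ⟨hij, hi⟩, determines_trans h hd hky⟩
    · exact ⟨k, Finset.mem_erase.2 ⟨hkj, hk⟩, hky⟩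
  exact Finset.notMem_erase j B (h1 hj)

/-- A minimal set of fibers without a colour preserving map has no octagons. -/
theorem block_of_minimal [Finite V] [Finite W] [DecidableEq ι] (h : Twin c d)
    (hs : SmallFibers c) {F : Finset ι}
    (hdet : ∀ i ∈ F, ∀ j ∈ F, i ≠ j → ¬ Determines c i j) (hn : ¬ Extends c d (F : Set ι))
    (hmin : ∀ G, G ⊂ F → Extends c d (G : Set ι)) {i j : ι} (hi : i ∈ F) (hj : j ∈ F)
    (hij : i ≠ j) : Block c i j := by
  rintro x x' z z' rfl hx' rfl hz' hc
  by_contra hne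
  -- Such a configuration lies on an octagon; by minimality there is a map on the remaining fibers,
  -- and `extends_octagon` carries it to all of `F`.
  have key : ∀ z0 z3, c z0 z0 = c z z → c z3 z3 = c z z → c x z3 = c x z0 → c x' z0 = c x z0 →
      c x' z3 ≠ c x z0 → False := by
    intro z0 z3 h0 h3 e1 e2 e3
    have hxz := hdet _ hi _ hj hij
    have hzx := hdet _ hj _ hi hij.symm
    obtain ⟨y, w, s, o, rfl, -, rfl, -⟩ := exists_octagon h.left hs hx' (h3.trans h0.symm)
      (by rwa [h0]) (by rwa [h0]) e1 e2 e3
    apply hn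
    have h1 : F = insert (c (y 0) (y 0))
        (insert (c (w 0) (w 0)) ((F.erase (c (w 0) (w 0))).erase (c (y 0) (y 0)))) := by
      rw [Finset.insert_comm, Finset.insert_erase, h0, Finset.insert_erase hj]
      rw [h0]
      exact Finset.mem_erase.2 ⟨hij, hi⟩
    rw [h1, Finset.coe_insert, Finset.coe_insert]
    refine h.extends_octagon hs o (by rwa [h0]) (by rwa [h0]) ?_ ?_ (hmin _ ?_)
    · intro k hk
      simp only [Finset.mem_coe, Finset.mem_erase] at hk
      exact hdet _ hk.2.2 _ hi hk.1
    · intro k hk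
      simp only [Finset.mem_coe, Finset.mem_erase] at hk
      rw [h0] at hk ⊢
      exact hdet _ hk.2.2 _ hj hk.2.1
    · rw [h0]
      exact (Finset.erase_subset _ _).trans_ssubset (Finset.erase_ssubset hj)
  -- If `x'` sees neither `z` nor `z'` in the colour `c x z`, it sees both in its other colour,
  -- since it does see `e z` in the colour `c x z`.
  obtain ⟨e, h1, h2, h3, h4, h5, h6, h7⟩ := h.left.exists_equiv hx'.symm
  have hT := atMostTwo h.left hs (hdet _ hi _ hj hij)
  by_cases k1 : c x' z = c x z
  · exact key z z' rfl hz' hc.symm k1 (fun hcon => hne (k1.trans hcon.symm))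
  · by_cases k2 : c x' z' = c x z
    · exact key z' z hz' rfl hc (k2.trans hc) (fun hcon => k1 (hcon.trans hc.symm))
    · apply hne
      rw [← h3 z] at k1 k2
      exact hT x' (e z) z z' hx' (h7 z) rfl hz' k1 k2

/-- Two partitions of a fiber into pairs that share a pair are equal. -/
theorem coarse_of_common [Finite V] (h : Twin c c) (hs : SmallFibers c) {x x' y y' : V}
    (hx : ¬ Determines c (c x x) (c y y)) (hx' : ¬ Determines c (c x' x') (c y y))
    (hy' : c y' y' = c y y) (hne : y' ≠ y) (e : c x y' = c x y) (e' : c x' y' = c x' y)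
    (hnu : ∃ w, c w w = c y y ∧ c x w ≠ c x y) {w w' : V} (hw : c w w = c y y)
    (hw' : c w' w' = c y y) (hc : c x w = c x w') : c x' w = c x' w' := by
  obtain ⟨a, ha, hane⟩ := hnu
  obtain ⟨p, b, hp, hb, ep, eb, n1, n2, n3, n4, n5, n6, hall⟩ := h.exists_halves hs hx ha hane
  have hp' : y' = p := by
    rcases hall y' hy' with rfl | rfl | rfl | rfl
    · exact (hne rfl).elim
    · exact (hane e).elim
    · rfl
    · exact (hane (eb.symm.trans e)).elim
  subst hp'
  -- The complement of the common pair is `{a, b}`; these points must share a class because no class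
  -- seen from `x'` is a singleton.
  have hab : c x' b = c x' a := by
    by_cases hu : c x' a = c x' y
    · by_contra hcon
      obtain ⟨t, ht, htne, htc⟩ := h.exists_partner (x := x') (y := b) (by rwa [hb])
      rcases hall t (ht.trans hb) with rfl | rfl | rfl | rfl
      · exact hcon (htc.symm.trans hu.symm)
      · exact hcon htc.symm
      · exact hcon (htc.symm.trans (e'.trans hu.symm))
      · exact htne rfl
    · obtain ⟨t, ht, htne, htc⟩ := h.exists_partner (x := x') (y := a) (by rwa [ha])
      rcases hall t (ht.trans ha) with rfl | rfl | rfl | rfl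
      · exact (hu htc.symm).elim
      · exact (htne rfl).elim
      · exact (hu (htc.symm.trans e')).elim
      · exact htc
  rcases hall w hw with rfl | rfl | rfl | rfl <;> rcases hall w' hw' with rfl | rfl | rfl | rfl <;>
    first | rfl | exact e'.symm | exact e' | exact hab | exact hab.symm | simp_all

/-- A configuration with at most sixteen points and fibers of size at most four is separable
or consists of four pairwise skew fibers. -/
theorem isSkewK4_of_not_extends [Finite V] [Finite W] (h : Twin c d) (hs : SmallFibers c)
    (hcard : Nat.card V ≤ 16) (hn : ¬ Extends c d Set.univ) :
    IsSkewK4 c ∧ 16 ≤ Nat.card V := by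
  classical
  have := Fintype.ofFinite V
  obtain ⟨B, hB, hdet⟩ := exists_basis h.left
  have hnB : ¬ Extends c d (B : Set ι) := fun hc => hn (h.extends_of_determines hB hc)
  obtain ⟨F, ⟨hFB, hnF⟩, hmin'⟩ := exists_minimal_of_wellFoundedLT
    (fun F : Finset ι => F ⊆ B ∧ ¬ Extends c d (F : Set ι)) ⟨B, subset_rfl, hnB⟩
  have hmin : ∀ G, G ⊂ F → Extends c d (G : Set ι) := by
    intro G hG
    by_contra hc
    exact hG.2 (hmin' ⟨hG.1.trans hFB, hc⟩ hG.1)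
  replace hdet : ∀ i ∈ F, ∀ j ∈ F, i ≠ j → ¬ Determines c i j := fun i hi j hj =>
    hdet i (hFB hi) j (hFB hj)
  have hblock : ∀ i ∈ F, ∀ j ∈ F, i ≠ j → Block c i j := fun i hi j hj hij =>
    h.block_of_minimal hs hdet hnF hmin hi hj hij
  have hne : ∀ j ∈ F, ∃ y, c y y = j := by
    intro j hj
    by_contra hcon
    push Not at hcon
    apply hnF
    obtain ⟨φ, hφ⟩ := hmin _ (Finset.erase_ssubset hj)
    exact ⟨φ, fun x y hx hy => hφ x y (by simpa [hcon x] using hx) (by simpa [hcon y] using hy)⟩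
  have hthree : ∀ y, c y y ∈ F → ∃ x2 x3 x4 : V,
      (c x2 x2 ∈ F ∧ c x2 x2 ≠ c y y) ∧ (c x3 x3 ∈ F ∧ c x3 x3 ≠ c y y) ∧
      (c x4 x4 ∈ F ∧ c x4 x4 ≠ c y y) ∧
      (∃ w, c w w = c y y ∧ c x2 w ≠ c x2 y) ∧
      (∃ w w', c w w = c y y ∧ c w' w' = c y y ∧ c x2 w = c x2 w' ∧ c x3 w ≠ c x3 w') ∧
      (∃ w w', c w w = c y y ∧ c w' w' = c y y ∧ c x2 w = c x2 w' ∧ c x4 w ≠ c x4 w') ∧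
      (∃ w w', c w w = c y y ∧ c w' w' = c y y ∧ c x3 w = c x3 w' ∧ c x4 w ≠ c x4 w') := by
    intro y hy
    have hG := hmin _ (Finset.erase_ssubset hy)
    -- The coarseness condition of `extends_insert` must fail for the fiber of `y`. So for any two
    -- observers there is a third whose partition coarsens neither; starting from one observer this
    -- yields a nontrivial partition, then a second and a third.
    have hstuck : ¬ _ := fun hcoarse => hnF (by
      rw [← Finset.insert_erase hy, Finset.coe_insert]
      refine h.extends_insert hs hG (fun i hi => ?_) (fun i hi => ?_) hcoarse
      · simp only [Finset.mem_coe, Finset.mem_erase] at hi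
        exact hblock _ hi.2 _ hy hi.1
      · simp only [Finset.mem_coe, Finset.mem_erase] at hi
        exact atMostTwo h.left hs (hdet _ hi.2 _ hy hi.1))
    simp only [Finset.mem_coe, Finset.mem_erase] at hstuck
    push Not at hstuck
    obtain ⟨⟨x0, hx0⟩, hstuck⟩ := hstuck
    obtain ⟨x2, hx2, ⟨p, q, hp, hq, -, hpq⟩, -⟩ := hstuck x0 x0 hx0 hx0
    obtain ⟨x3, hx3, h32, -⟩ := hstuck x2 x2 hx2 hx2
    obtain ⟨x4, hx4, h42, h43⟩ := hstuck x2 x3 hx2 hx3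
    refine ⟨x2, x3, x4, ⟨hx2.2, hx2.1⟩, ⟨hx3.2, hx3.1⟩, ⟨hx4.2, hx4.1⟩, ?_, h32, h42, h43⟩
    by_cases hpy : c x2 p = c x2 y
    · exact ⟨q, hq, fun hc => hpq (hpy.trans hc.symm)⟩
    · exact ⟨p, hp, hpy⟩
  have hdist : ∀ y, c y y ∈ F → ∀ a b, c a a ∈ F → c a a ≠ c y y →
      (∃ w w', c w w = c y y ∧ c w' w' = c y y ∧ c a w = c a w' ∧ c b w ≠ c b w') →
      c a a ≠ c b b := by
    rintro y hy a b ha hay ⟨w, w', hw, hw', e1, e2⟩ hab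
    exact e2 (hblock _ ha _ hy hay a b w w' rfl hab.symm hw hw' e1)
  have hnonempty : F.Nonempty := by
    rw [Finset.nonempty_iff_ne_empty]
    rintro rfl
    apply hnF
    rcases isEmpty_or_nonempty V with hV | ⟨⟨x⟩⟩
    · exact ⟨fun x => (hV.false x).elim, fun x => (hV.false x).elim⟩
    · obtain ⟨u, -⟩ := h.surj_left x
      exact ⟨fun _ => u, by simp⟩
  have hF4 : 4 ≤ F.card := by
    obtain ⟨j, hj⟩ := hnonempty
    obtain ⟨y, rfl⟩ := hne j hj
    obtain ⟨x2, x3, x4, h2, h3, h4, -, h32, h42, h43⟩ := hthree y hj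
    have d32 := hdist y hj _ _ h2.1 h2.2 h32
    have d42 := hdist y hj _ _ h2.1 h2.2 h42
    have d43 := hdist y hj _ _ h3.1 h3.2 h43
    have hsub : ({c y y, c x2 x2, c x3 x3, c x4 x4} : Finset ι) ⊆ F := by
      intro i hi
      simp only [Finset.mem_insert, Finset.mem_singleton] at hi
      rcases hi with rfl | rfl | rfl | rfl
      exacts [hj, h2.1, h3.1, h4.1]
    refine le_trans (le_of_eq ?_) (Finset.card_le_card hsub)
    rw [Finset.card_insert_of_notMem, Finset.card_insert_of_notMem, Finset.card_insert_of_notMem,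
      Finset.card_singleton] <;> simp [d32, d42, d43, h2.2.symm, h3.2.symm, h4.2.symm]
  have hsize : ∀ j ∈ F, 4 ≤ (Finset.univ.filter fun x => c x x = j).card := by
    intro j hj
    obtain ⟨y, rfl⟩ := hne j hj
    obtain ⟨x2, x3, x4, h2, h3, h4, ⟨w, hw, hwne⟩, -⟩ := hthree y hj
    obtain ⟨p, q, hp, hq, -, -, n1, n2, n3, n4, n5, n6, -⟩ :=
      h.left.exists_halves hs (hdet _ h2.1 _ hj h2.2) hw hwne
    have hsub : ({y, w, p, q} : Finset V) ⊆ Finset.univ.filter fun x => c x x = c y y := by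
      intro i hi
      simp only [Finset.mem_insert, Finset.mem_singleton] at hi
      rcases hi with rfl | rfl | rfl | rfl <;> simp [hw, hp, hq]
    refine le_trans (le_of_eq ?_) (Finset.card_le_card hsub)
    rw [Finset.card_insert_of_notMem, Finset.card_insert_of_notMem, Finset.card_insert_of_notMem,
      Finset.card_singleton] <;> simp [*]
  let I : Finset ι := Finset.univ.image fun x => c x x
  have hFI : F ⊆ I := by
    intro j hj
    obtain ⟨y, rfl⟩ := hne j hj
    exact Finset.mem_image_of_mem _ (Finset.mem_univ y)
  have hVI : Nat.card V = ∑ i ∈ I, (Finset.univ.filter fun x => c x x = i).card := by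
    rw [Nat.card_eq_fintype_card, ← Finset.card_univ]
    exact Finset.card_eq_sum_card_fiberwise fun x _ => Finset.mem_image_of_mem _ (Finset.mem_univ x)
  have hsplit := Finset.sum_sdiff (f := fun i => (Finset.univ.filter fun x => c x x = i).card) hFI
  have hFsum : F.card • 4 ≤ ∑ i ∈ F, (Finset.univ.filter fun x => c x x = i).card :=
    Finset.card_nsmul_le_sum _ _ _ hsize
  rw [smul_eq_mul] at hFsum
  -- At least four fibers with at least four points each already use up all the points.
  have hrest : ∑ i ∈ I \ F, (Finset.univ.filter fun x => c x x = i).card = 0 := by omega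
  have hallF : ∀ x, c x x ∈ F := by
    intro x
    by_contra hx
    have h1 := Finset.sum_eq_zero_iff.1 hrest (c x x)
      (Finset.mem_sdiff.2 ⟨Finset.mem_image_of_mem _ (Finset.mem_univ x), hx⟩)
    rw [Finset.card_eq_zero] at h1
    exact Finset.notMem_empty x (h1 ▸ by simp)
  have hF4' : F.card = 4 := by omega
  have hIF : {i | ∃ x, c x x = i} = (F : Set ι) := by
    ext i
    exact ⟨fun ⟨x, hx⟩ => hx ▸ hallF x, fun hi => hne i hi⟩
  have hcov : ∀ y, ∃ x2 x3 x4 : V, c x2 x2 ≠ c y y ∧ c x3 x3 ≠ c y y ∧ c x4 x4 ≠ c y y ∧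
      (∀ x, c x x ≠ c y y → c x x = c x2 x2 ∨ c x x = c x3 x3 ∨ c x x = c x4 x4) ∧
      (∃ w, c w w = c y y ∧ c x2 w ≠ c x2 y) ∧
      (∃ w w', c w w = c y y ∧ c w' w' = c y y ∧ c x2 w = c x2 w' ∧ c x3 w ≠ c x3 w') ∧
      (∃ w w', c w w = c y y ∧ c w' w' = c y y ∧ c x2 w = c x2 w' ∧ c x4 w ≠ c x4 w') ∧
      (∃ w w', c w w = c y y ∧ c w' w' = c y y ∧ c x3 w = c x3 w' ∧ c x4 w ≠ c x4 w') := by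
    intro y
    have hj := hallF y
    obtain ⟨x2, x3, x4, h2, h3, h4, hw, h32, h42, h43⟩ := hthree y hj
    refine ⟨x2, x3, x4, h2.2, h3.2, h4.2, ?_, hw, h32, h42, h43⟩
    have d32 := hdist y hj _ _ h2.1 h2.2 h32
    have d42 := hdist y hj _ _ h2.1 h2.2 h42
    have d43 := hdist y hj _ _ h3.1 h3.2 h43
    have hsub : ({c y y, c x2 x2, c x3 x3, c x4 x4} : Finset ι) ⊆ F := by
      intro i hi
      simp only [Finset.mem_insert, Finset.mem_singleton] at hi
      rcases hi with rfl | rfl | rfl | rfl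
      exacts [hj, h2.1, h3.1, h4.1]
    have heq := Finset.eq_of_subset_of_card_le hsub (by
      rw [hF4']
      refine le_of_eq (Eq.symm ?_)
      rw [Finset.card_insert_of_notMem, Finset.card_insert_of_notMem,
        Finset.card_insert_of_notMem, Finset.card_singleton] <;>
        simp [d32, d42, d43, h2.2.symm, h3.2.symm, h4.2.symm])
    intro x hx
    have := hallF x
    rw [← heq] at this
    simpa [hx] using this
  have hB' : ∀ x y, c x x ≠ c y y → Block c (c x x) (c y y) := fun x y hxy =>
    hblock _ (hallF x) _ (hallF y) hxy
  have hnu : ∀ x y, c x x ≠ c y y → ∃ w, c w w = c y y ∧ c x w ≠ c x y := by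
    intro x y hxy
    obtain ⟨x2, x3, x4, h2, h3, h4, hc, ⟨a, ha, hane⟩, ⟨p, p', hp, hp', -, hpp⟩,
      ⟨q, q', hq, hq', -, hqq⟩, -⟩ := hcov y
    have key : ∀ b, c b b = c x x → ∀ w w', c w w = c y y → c w' w' = c y y → c b w ≠ c b w' →
        ∃ w, c w w = c y y ∧ c x w ≠ c x y := by
      intro b hb w w' hw hw' hne
      by_contra hcon
      push Not at hcon
      exact hne (hB' x y hxy x b w w' rfl hb hw hw' ((hcon w hw).trans (hcon w' hw').symm))
    rcases hc x hxy with hc | hc | hc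
    · exact key x2 hc.symm a y ha rfl hane
    · exact key x3 hc.symm _ _ hp hp' hpp
    · exact key x4 hc.symm _ _ hq hq' hqq
  have hD : ∀ x y, c x x ≠ c y y → ¬ Determines c (c x x) (c y y) := fun x y hxy =>
    hdet _ (hallF x) _ (hallF y) hxy
  refine ⟨⟨by rw [hIF, Set.ncard_coe_finset, hF4'], hB', ?_, ?_⟩, by omega⟩
  · intro x y hxy
    obtain ⟨w, hw, hwne⟩ := hnu x y hxy
    obtain ⟨p, q, hp, hq, ep, eq, n1, n2, n3, n4, n5, n6, hall⟩ :=
      h.left.exists_halves hs (hD x y hxy) hw hwne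
    exact ⟨p, w, q, hp, hw, hq, ep, eq, hwne, n2, n1, n3, n4.symm, n6, n5,
      fun t ht => by rcases hall t ht with k | k | k | k <;> simp [k]⟩
  · intro x x' y y' hx hx' hxx hy' hyy e1 e2
    have key : ∀ a b, c a a ≠ c y y → c b b ≠ c y y → c a y' = c a y → c b y' = c b y →
        ¬ ∃ w w', c w w = c y y ∧ c w' w' = c y y ∧ c a w = c a w' ∧ c b w ≠ c b w' := by
      rintro a b ha hb f1 f2 ⟨w, w', hw, hw', f3, f4⟩
      exact f4 (coarse_of_common h.left hs (hD _ _ ha) (hD _ _ hb) hy' hyy f1 f2 (hnu a y ha)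
        hw hw' f3)
    have tr : ∀ a b, c a a ≠ c y y → c b b = c a a → c a y' = c a y → c b y' = c b y :=
      fun a b ha hb f => hB' a y ha a b y' y rfl hb hy' rfl f
    obtain ⟨x2, x3, x4, h2, h3, h4, hc, -, h32, h42, h43⟩ := hcov y
    rcases hc x hx with k | k | k <;> rcases hc x' hx' with k' | k' | k'
    · exact hxx (k.trans k'.symm)
    · exact key x2 x3 h2 h3 (tr x x2 hx k.symm e1) (tr x' x3 hx' k'.symm e2) h32
    · exact key x2 x4 h2 h4 (tr x x2 hx k.symm e1) (tr x' x4 hx' k'.symm e2) h42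
    · exact key x2 x3 h2 h3 (tr x' x2 hx' k'.symm e2) (tr x x3 hx k.symm e1) h32
    · exact hxx (k.trans k'.symm)
    · exact key x3 x4 h3 h4 (tr x x3 hx k.symm e1) (tr x' x4 hx' k'.symm e2) h43
    · exact key x2 x4 h2 h4 (tr x' x2 hx' k'.symm e2) (tr x x4 hx k.symm e1) h42
    · exact key x3 x4 h3 h4 (tr x' x3 hx' k'.symm e2) (tr x x4 hx k.symm e1) h43
    · exact hxx (k.trans k'.symm)

end Twin

/-! ### Configurations from colourings and a test for non-separability -/

namespace CoherentConfiguration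

variable {V : Type u} {W : Type v} {K : Type*}

/-- The coherent configuration whose basis relations are the classes of a pair colouring. -/
def ofColor (c : V → V → K) (hloop : ∀ {x y z}, c x x = c y z → y = z)
    (htransp : ∀ {x y u v}, c x y = c u v → c y x = c v u)
    (hbij : ∀ {x y u v}, c x y = c u v →
      ∃ e : V ≃ V, ∀ w, c u (e w) = c x w ∧ c (e w) v = c w y) : CoherentConfiguration V where
  rels := {R | ∃ x y, R = {p | c p.1 p.2 = c x y}}
  isPartition := by
    refine ⟨?_, fun p => ⟨{q | c q.1 q.2 = c p.1 p.2}, ⟨⟨p.1, p.2, rfl⟩, rfl⟩, ?_⟩⟩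
    · rintro ⟨x, y, hR⟩
      exact Set.notMem_empty (x, y) (hR ▸ rfl)
    · rintro R ⟨⟨x, y, rfl⟩, hp⟩
      rw [show c p.1 p.2 = c x y from hp]
  loops := by
    rintro R ⟨x, y, rfl⟩ z hz p hp
    exact hloop (hz.trans hp.symm)
  transpose := by
    rintro R ⟨x, y, rfl⟩
    exact ⟨y, x, Set.ext fun p => ⟨fun hp => htransp hp, fun hp => htransp hp⟩⟩
  coherent := by
    rintro R ⟨x, y, rfl⟩ S ⟨x', y', rfl⟩ T ⟨x'', y'', rfl⟩ p hp q hq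
    obtain ⟨e, he⟩ := hbij ((show c p.1 p.2 = c x'' y'' from hp).trans hq.symm)
    have h1 : {w | (q.1, w) ∈ {p : V × V | c p.1 p.2 = c x y} ∧
        (w, q.2) ∈ {p : V × V | c p.1 p.2 = c x' y'}} =
        e '' {w | (p.1, w) ∈ {p : V × V | c p.1 p.2 = c x y} ∧
        (w, p.2) ∈ {p : V × V | c p.1 p.2 = c x' y'}} := by
      ext w
      obtain ⟨w, rfl⟩ := e.surjective w
      simp [he]
    rw [pathCount, pathCount, h1, Set.ncard_image_of_injective _ e.injective]

section

variable {c : V → V → K} {hloop : ∀ {x y z}, c x x = c y z → y = z}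
  {htransp : ∀ {x y u v}, c x y = c u v → c y x = c v u}
  {hbij : ∀ {x y u v}, c x y = c u v →
    ∃ e : V ≃ V, ∀ w, c u (e w) = c x w ∧ c (e w) v = c w y}

theorem ofColor_color_eq_iff {x y u v : V} :
    (ofColor c hloop htransp hbij).color x y = (ofColor c hloop htransp hbij).color u v ↔
      c x y = c u v := by
  have h1 : {p | c p.1 p.2 = c u v} ∈ (ofColor c hloop htransp hbij).rels := ⟨u, v, rfl⟩
  have h2 := (ofColor c hloop htransp hbij).mem_iff_color ⟨_, h1⟩
  rw [(h2 u v).1 rfl, ← h2]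
  rfl

theorem isCombinatorialIso_ofColor {C : CoherentConfiguration W} (φ : W ≃ V)
    (hφ : ∀ x y u v, C.color x y = C.color u v ↔ c (φ x) (φ y) = c (φ u) (φ v)) :
    C.IsCombinatorialIso (ofColor c hloop htransp hbij) φ := by
  intro R hR
  obtain ⟨x, y, hxy⟩ := C.exists_color ⟨R, hR⟩
  refine ⟨φ x, φ y, ?_⟩
  ext ⟨u, v⟩
  obtain ⟨u, rfl⟩ := φ.surjective u
  obtain ⟨v, rfl⟩ := φ.surjective v
  simp only [Set.mem_image, Prod.exists, Prod.map_apply, Prod.mk.injEq,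
    EmbeddingLike.apply_eq_iff_eq, Set.mem_ofPred_eq]
  rw [← hφ, hxy, ← C.mem_iff_color]
  constructor
  · rintro ⟨a, b, h, rfl, rfl⟩
    exact h
  · exact fun h => ⟨u, v, h, rfl, rfl⟩

/-- A permutation of the colours that respects triangle counts, but is not induced by a
permutation of the points, witnesses non-separability. -/
theorem not_separable_ofColor [Finite V] (σ : K → K) (hσ : ∀ k, σ (σ k) = k)
    (hex : ∀ x y, ∃ u v, c u v = σ (c x y))
    (hloc : ∀ {x y u v}, c u v = σ (c x y) →
      ∃ e : V ≃ V, ∀ w, c u (e w) = σ (c x w) ∧ c (e w) v = σ (c w y))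
    (hno : ¬ ∃ φ : V → V, ∀ x y, c (φ x) (φ y) = σ (c x y)) :
    ¬ (ofColor c hloop htransp hbij).Separable := by
  set T := ofColor c hloop htransp hbij with hT
  have hmem : ∀ {R : Set (V × V)}, R ∈ T.rels → {p : V × V | ∃ q ∈ R, c p.1 p.2 = σ (c q.1 q.2)} ∈
      T.rels := by
    rintro R ⟨x, y, rfl⟩
    obtain ⟨u, v, huv⟩ := hex x y
    refine ⟨u, v, ?_⟩
    ext p
    constructor
    · rintro ⟨q, hq, hp⟩
      exact hp.trans ((congrArg σ hq).trans huv.symm)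
    · intro hp
      exact ⟨(x, y), rfl, (show c p.1 p.2 = c u v from hp).trans huv⟩
  have hinv : ∀ {R : Set (V × V)}, R ∈ T.rels → {p : V × V | ∃ q ∈
      {p : V × V | ∃ q ∈ R, c p.1 p.2 = σ (c q.1 q.2)}, c p.1 p.2 = σ (c q.1 q.2)} = R := by
    rintro R ⟨x, y, rfl⟩
    ext p
    constructor
    · rintro ⟨q, ⟨q', hq', hq⟩, hp⟩
      change c p.1 p.2 = c x y
      rw [hp, hq, hσ]
      exact hq'
    · intro hp
      obtain ⟨u, v, huv⟩ := hex p.1 p.2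
      exact ⟨(u, v), ⟨p, hp, huv⟩, by rw [huv, hσ]⟩
  let f : T.rels ≃ T.rels :=
    { toFun := fun R => ⟨_, hmem R.2⟩
      invFun := fun R => ⟨_, hmem R.2⟩
      left_inv := fun R => Subtype.ext (hinv R.2)
      right_inv := fun R => Subtype.ext (hinv R.2) }
  have hcol : ∀ {x y u v}, f (T.color x y) = T.color u v ↔ c u v = σ (c x y) := by
    intro x y u v
    rw [eq_comm, ← T.mem_iff_color]
    constructor
    · rintro ⟨q, hq, h⟩
      rw [h]
      congr 1
      exact ofColor_color_eq_iff.1 ((T.mem_iff_color _ _ _).1 hq)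
    · intro h
      exact ⟨(x, y), T.mem_color x y, h⟩
  have hf : T.IsAlgebraicIso T f := by
    intro R S U
    obtain ⟨x, y, rfl⟩ := T.exists_color U
    obtain ⟨u, v, huv⟩ := hex x y
    obtain ⟨e, he⟩ := hloc huv
    rw [hcol.2 huv, T.intersectionNumber_color, T.intersectionNumber_color]
    refine Nat.card_congr (e.subtypeEquiv fun w => ?_)
    rw [← hcol.2 (he w).1, ← hcol.2 (he w).2, f.apply_eq_iff_eq, f.apply_eq_iff_eq]
  intro hsep
  obtain ⟨φ, -, hφ⟩ := hsep V T f hf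
  refine hno ⟨φ, fun x y => hcol.1 ?_⟩
  rw [eq_comm, ← T.mem_iff_color, hφ]
  exact ⟨(x, y), T.mem_color x y, rfl⟩

end

end CoherentConfiguration

/-! ### The model over the field with two elements -/

namespace SkewK4

/-- The plane over the field with two elements. -/
abbrev Plane : Type := ZMod 2 × ZMod 2

/-- The standard bilinear form. -/
def form (k a : Plane) : ZMod 2 := k.1 * a.1 + k.2 * a.2

theorem form_add (k a b : Plane) : form k (a + b) = form k a + form k b := by
  simp only [form, Prod.fst_add, Prod.snd_add]; ring

/-- The colouring of the pairs of points `(i, a)`, where `i` is the fiber of the point. -/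
def col (p q : Plane × Plane) : Plane × Plane × Plane :=
  (p.1, q.1, if p.1 = q.1 then p.2 + q.2 else (form (p.1 + q.1) (p.2 + q.2), 0))

/-- The indicator of the pairs of fibers containing the fiber `0` (multiplied by `δ`). -/
def star (δ : ZMod 2) (i j : Plane) : ZMod 2 := if i = 0 ∨ j = 0 then δ else 0

/-- Exchange the two colours in all interspaces at the fiber `0`, if `δ = 1`. -/
def twist (δ : ZMod 2) (k : Plane × Plane × Plane) : Plane × Plane × Plane :=
  if k.1 = k.2.1 then k else (k.1, k.2.1, k.2.2 + (star δ k.1 k.2.1, 0))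

theorem twist_col_of_ne (δ : ZMod 2) {i j : Plane} (hij : i ≠ j) (a b : Plane) :
    twist δ (col (i, a) (j, b)) = (i, j, (form (i + j) (a + b) + star δ i j, 0)) := by
  simp [twist, col, hij]

theorem twist_col_self (δ : ZMod 2) (i a b : Plane) :
    twist δ (col (i, a) (i, b)) = (i, i, a + b) := by
  simp [twist, col]

theorem col_of_ne {i j : Plane} (hij : i ≠ j) (a b : Plane) :
    col (i, a) (j, b) = (i, j, (form (i + j) (a + b), 0)) := by
  simp [col, hij]

theorem col_self (i a b : Plane) : col (i, a) (i, b) = (i, i, a + b) := by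
  simp [col]

theorem col_loop {p q r : Plane × Plane} (h : col p p = col q r) : q = r := by
  obtain ⟨i, a⟩ := p
  obtain ⟨j, b⟩ := q
  obtain ⟨k, d⟩ := r
  have h1 : i = j := congrArg (·.1) h
  have h2 : i = k := congrArg (·.2.1) h
  subst h1 h2
  rw [col_self, col_self] at h
  have h3 : a + a = b + d := congrArg (·.2.2) h
  have h4 : ∀ a b d : Plane, a + a = b + d → b = d := by decide
  rw [h4 a b d h3]

theorem col_transp {p q r t : Plane × Plane} (h : col p q = col r t) : col q p = col t r := by
  obtain ⟨i, a⟩ := p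
  obtain ⟨j, b⟩ := q
  obtain ⟨i', a'⟩ := r
  obtain ⟨j', b'⟩ := t
  have h1 : i = i' := congrArg (·.1) h
  have h2 : j = j' := congrArg (·.2.1) h
  subst h1 h2
  by_cases hij : i = j
  · subst hij
    rw [col_self, col_self] at h ⊢
    have h3 : a + b = a' + b' := congrArg (·.2.2) h
    rw [add_comm b, add_comm b', h3]
  · rw [col_of_ne hij, col_of_ne hij] at h
    have h3 : form (i + j) (a + b) = form (i + j) (a' + b') := congrArg (·.2.2.1) h
    rw [col_of_ne (Ne.symm hij), col_of_ne (Ne.symm hij), add_comm b, add_comm b', add_comm j, h3]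

-- For `l` different from distinct `i` and `k`, the vectors `i + l` and `l + k` are distinct and
-- nonzero, hence independent, so the two linear equations for `m` have a solution. For `i = k` both
-- equations coincide, as `s = t`.
set_option synthInstance.maxSize 1000 in
set_option synthInstance.maxHeartbeats 400000 in
theorem exists_shift : ∀ (δ : ZMod 2) (i k s t : Plane), (i = k → s = t) →
    (i ≠ k → form (i + k) (s + t) = star δ i k) → ∀ l : Plane, ∃ m : Plane,
      (l = i → m = s) ∧ (l = k → m = t) ∧ (i ≠ l → form (i + l) (s + m) = star δ i l) ∧
      (l ≠ k → form (l + k) (m + t) = star δ l k) := by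
  decide +kernel

/-- The bijection translates each fiber `l` by a vector `τ l`. By linearity this changes an
interspace colour by a constant, so `exists_shift` supplies what is needed. The case `δ = 0` gives
coherence of the model, and `δ = 1` the algebraic automorphism. -/
theorem exists_twist_equiv (δ : ZMod 2) {p q p' q' : Plane × Plane}
    (h : col p' q' = twist δ (col p q)) : ∃ e : Plane × Plane ≃ Plane × Plane,
      ∀ w, col p' (e w) = twist δ (col p w) ∧ col (e w) q' = twist δ (col w q) := by
  obtain ⟨i, a⟩ := p
  obtain ⟨k, b⟩ := q
  obtain ⟨i', a'⟩ := p'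
  obtain ⟨k', b'⟩ := q'
  have tw1 : (twist δ (col (i, a) (k, b))).1 = i := by unfold twist; split_ifs <;> rfl
  have tw2 : (twist δ (col (i, a) (k, b))).2.1 = k := by unfold twist; split_ifs <;> rfl
  obtain rfl : i' = i := (congrArg (·.1) h).trans tw1
  obtain rfl : k' = k := (congrArg (·.2.1) h).trans tw2
  have cancel : ∀ a s : Plane, ∃ t, s = a + t := by decide
  have dbl : ∀ a s t : Plane, a + s + (t + s) = a + t := by decide
  have dbl' : ∀ a s b t : Plane, a + s + (b + t) = a + b → s = t := by decide
  have dbl'' : ∀ a b d : ZMod 2, a + b = a + d → b = d := by decide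
  have four : ∀ a s b t : Plane, a + s + (b + t) = (a + b) + (s + t) := by decide
  have inv : ∀ a s : Plane, a + s + s = a := by decide
  obtain ⟨s, rfl⟩ := cancel a a'
  obtain ⟨t, rfl⟩ := cancel b b'
  choose τ h1 h2 h3 h4 using exists_shift δ i' k' s t
    (by
      rintro rfl
      rw [col_self, twist_col_self] at h
      exact dbl' _ _ _ _ (congrArg (·.2.2) h))
    (by
      intro hik
      rw [col_of_ne hik, twist_col_of_ne δ hik, four, form_add] at h
      exact dbl'' _ _ _ (congrArg (·.2.2.1) h))
  refine ⟨⟨fun w => (w.1, w.2 + τ w.1), fun w => (w.1, w.2 + τ w.1), fun w => ?_, fun w => ?_⟩, ?_⟩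
  · simp only [inv]
  · simp only [inv]
  rintro ⟨l, w⟩
  simp only [Equiv.coe_fn_mk]
  constructor
  · by_cases hl : i' = l
    · subst hl
      rw [col_self, twist_col_self, h1 i' rfl, dbl]
    · rw [col_of_ne hl, twist_col_of_ne δ hl, four, form_add _ (a + w), h3 l hl]
  · by_cases hl : l = k'
    · subst hl
      rw [col_self, twist_col_self, h2 l rfl, dbl]
    · rw [col_of_ne hl, twist_col_of_ne δ hl, four, form_add _ (w + b), h4 l hl]

theorem twist_zero (k : Plane × Plane × Plane) : twist 0 k = k := by
  obtain ⟨i, j, m⟩ := k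
  simp [twist, star]

theorem twist_twist (δ : ZMod 2) (k : Plane × Plane × Plane) : twist δ (twist δ k) = k := by
  obtain ⟨i, j, m⟩ := k
  have h : ∀ (m : Plane) (a : ZMod 2), m + (a, 0) + (a, 0) = m := by decide
  by_cases hij : i = j
  · simp [twist, hij]
  · simp only [twist, if_neg hij, h]

set_option synthInstance.maxSize 1000 in
set_option synthInstance.maxHeartbeats 400000 in
/-- Parity obstruction: the colours at the fiber `0` cannot be exchanged by a map on the points. -/
theorem not_exists_twist_map :
    ¬ ∃ φ : Plane × Plane → Plane × Plane, ∀ p q, col (φ p) (φ q) = twist 1 (col p q) := by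
  rintro ⟨φ, hφ⟩
  have hfst : ∀ i, (φ (i, 0)).1 = i := by
    intro i
    have h := hφ (i, 0) (i, 0)
    rw [twist_col_self] at h
    exact congrArg (·.1) h
  have key : ∀ i j, i ≠ j → form (i + j) ((φ (i, 0)).2 + (φ (j, 0)).2) = star 1 i j := by
    intro i j hij
    have h := hφ (i, 0) (j, 0)
    rw [twist_col_of_ne 1 hij, ← Prod.mk.eta (p := φ (i, 0)), ← Prod.mk.eta (p := φ (j, 0)),
      hfst, hfst, col_of_ne hij] at h
    simpa [form] using congrArg (·.2.2.1) h
  -- In the sum of the six equations each of `a`, `b`, `d`, `e` is paired with the sum of the three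
  -- nonzero vectors, which vanishes; the right-hand sides add up to three, that is to one.
  have hno : ∀ a b d e : Plane, form ((0, 0) + (0, 1)) (a + b) = star 1 (0, 0) (0, 1) →
      form ((0, 0) + (1, 0)) (a + d) = star 1 (0, 0) (1, 0) →
      form ((0, 0) + (1, 1)) (a + e) = star 1 (0, 0) (1, 1) →
      form ((0, 1) + (1, 0)) (b + d) = star 1 (0, 1) (1, 0) →
      form ((0, 1) + (1, 1)) (b + e) = star 1 (0, 1) (1, 1) →
      form ((1, 0) + (1, 1)) (d + e) = star 1 (1, 0) (1, 1) → False := by decide +kernel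
  exact hno _ _ _ _ (key (0, 0) (0, 1) (by decide)) (key (0, 0) (1, 0) (by decide))
    (key (0, 0) (1, 1) (by decide)) (key (0, 1) (1, 0) (by decide)) (key (0, 1) (1, 1) (by decide))
    (key (1, 0) (1, 1) (by decide))

/-- A numbering of the points. -/
noncomputable def coord : Fin 16 ≃ Plane × Plane :=
  (Fintype.equivFinOfCardEq (by simp)).symm

/-- The colouring transported to `Fin 16`. -/
noncomputable def finCol (x y : Fin 16) : Plane × Plane × Plane := col (coord x) (coord y)

theorem exists_twist_equiv_fin (δ : ZMod 2) {x y u v : Fin 16}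
    (h : finCol u v = twist δ (finCol x y)) : ∃ e : Fin 16 ≃ Fin 16,
      ∀ w, finCol u (e w) = twist δ (finCol x w) ∧ finCol (e w) v = twist δ (finCol w y) := by
  obtain ⟨e, he⟩ := exists_twist_equiv δ h
  refine ⟨(coord.trans e).trans coord.symm, fun w => ?_⟩
  simpa [finCol] using he (coord w)

theorem finCol_loop {x y z : Fin 16} (h : finCol x x = finCol y z) : y = z :=
  coord.injective (col_loop h)

theorem finCol_transp {x y u v : Fin 16} (h : finCol x y = finCol u v) :
    finCol y x = finCol v u :=
  col_transp h

theorem finCol_bij {x y u v : Fin 16} (h : finCol x y = finCol u v) : ∃ e : Fin 16 ≃ Fin 16,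
    ∀ w, finCol u (e w) = finCol x w ∧ finCol (e w) v = finCol w y := by
  obtain ⟨e, he⟩ := exists_twist_equiv_fin 0 (x := x) (y := y) (u := u) (v := v)
    (by rw [twist_zero, h])
  exact ⟨e, fun w => by simpa only [twist_zero] using he w⟩

/-- The skew-connected coherent configuration on four fibers of size four. -/
noncomputable def config : CoherentConfiguration (Fin 16) :=
  CoherentConfiguration.ofColor finCol finCol_loop finCol_transp finCol_bij

theorem not_separable : ¬ config.Separable := by
  refine CoherentConfiguration.not_separable_ofColor (hloop := finCol_loop)
    (htransp := finCol_transp) (hbij := finCol_bij) (twist 1) (twist_twist 1) ?_ ?_ ?_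
  · intro x y
    have h : ∀ p q : Plane × Plane, ∃ r t, col r t = twist 1 (col p q) := by
      rintro ⟨i, a⟩ ⟨j, b⟩
      by_cases hij : i = j
      · subst hij
        exact ⟨(i, a), (i, b), by rw [twist_col_self, col_self]⟩
      · have h2 : ∀ (k : Plane) (m : ZMod 2), k ≠ 0 → ∃ t, form k t = m := by decide
        have h3 : ∀ i j : Plane, i ≠ j → i + j ≠ 0 := by decide
        obtain ⟨t, ht⟩ := h2 (i + j) (star 1 i j) (h3 i j hij)
        exact ⟨(i, a), (j, b + t), by
          rw [twist_col_of_ne 1 hij, col_of_ne hij, ← add_assoc, form_add _ (a + b), ht]⟩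
    obtain ⟨r, t, hrt⟩ := h (coord x) (coord y)
    exact ⟨coord.symm r, coord.symm t, by simpa [finCol] using hrt⟩
  · exact exists_twist_equiv_fin 1
  · rintro ⟨φ, hφ⟩
    refine not_exists_twist_map ⟨fun p => coord (φ (coord.symm p)), fun p q => ?_⟩
    simpa [finCol] using hφ (coord.symm p) (coord.symm q)

end SkewK4

/-! ### Coordinates and uniqueness -/

namespace Twin.IsSkewK4

open SkewK4

variable {V ι : Type*} {c : V → V → ι}

/-- An interspace has only two colours: every point of the first fiber sees both of them. -/
theorem eq_of_ne (s : IsSkewK4 c) (h : Twin c c) {x x' x'' y y' y'' : V} (hxy : c x x ≠ c y y)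
    (hx' : c x' x' = c x x) (hx'' : c x'' x'' = c x x) (hy' : c y' y' = c y y)
    (hy'' : c y'' y'' = c y y) (h1 : c x' y' ≠ c x y) (h2 : c x'' y'' ≠ c x y) :
    c x' y' = c x'' y'' := by
  obtain ⟨t, ht⟩ := h.exists_right hx'.symm y
  obtain ⟨t', ht'⟩ := h.exists_right (hx''.trans hx'.symm) y''
  have e1 : c t t = c y y := (h.snd_eq ht).symm
  have e2 : c t' t' = c y y := (h.snd_eq ht').symm.trans hy''
  obtain ⟨y1, y2, y3, -, -, -, f1, f3, -, -, -, -, -, -, -, hall⟩ :=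
    s.halves x' t (by rwa [hx', e1])
  rw [ht] at h1 h2
  rw [ht'] at h2 ⊢
  have key : ∀ w, c w w = c t t → c x' w ≠ c x' t → c x' w = c x' y2 := by
    intro w hw hne
    rcases hall w hw with rfl | rfl | rfl | rfl
    · exact (hne rfl).elim
    · exact (hne f1).elim
    · rfl
    · exact f3
  rw [key y' (hy'.trans e1.symm) h1, key t' (e2.trans e1.symm) h2]

/-- Coordinates on a configuration of four pairwise skew fibers. -/
theorem exists_coordinates [Finite V] (s : IsSkewK4 c) (h : Twin c c) :
    ∃ P : Plane × Plane → V, Function.Bijective P ∧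
      ∀ p q p' q', c (P p) (P q) = c (P p') (P q') ↔ col p q = col p' q' := by
  classical
  -- For `a ≠ 0`, `J a` is the only nonzero `k` with `form k a = 0`. Accordingly `P i a` is taken to
  -- be the partner of the base point `y i` in the matching coming from the fiber `i + J a`.
  let J : Plane → Plane := fun k => (k.2, k.1)
  have f1 : ∀ i a : Plane, a ≠ 0 → i + J a ≠ i := by decide
  have f1' : ∀ i a a' : Plane, a ≠ a' → i + J a ≠ i + J a' := by decide
  have f2 : ∀ i j a : Plane, i ≠ j → a ≠ 0 → (form (i + j) a = 0 ↔ i + J a = j) := by decide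
  have f3 : ∀ u w : ZMod 2, u ≠ 0 → w ≠ 0 → u + w = 0 := by decide
  have f4 : ∀ u w : ZMod 2, u = 0 → w ≠ 0 → u + w ≠ 0 := by decide
  have f5 : ∀ u u' : Plane, (∀ k, k ≠ 0 → (form k u = 0 ↔ form k u' = 0)) → u = u' := by decide
  have f6 : ∀ a b b' : Plane, a + b = a + b' → b = b' := fun _ _ _ => add_left_cancel
  have f7 : ∀ i k : Plane, k ≠ 0 → i ≠ i + k := by decide
  have f8 : ∀ i k : Plane, i + (i + k) = k := by decide
  have f9 : ∀ u w : ZMod 2, u ≠ 0 → w ≠ 0 → u = w := by decide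
  obtain ⟨g⟩ : Nonempty (Plane ≃ {i | ∃ x, c x x = i}) := by
    have : Finite {i | ∃ x, c x x = i} := Set.finite_coe_iff.2 (Set.finite_range fun x => c x x)
    apply Finite.card_eq.1
    rw [Nat.card_coe_set_eq, s.card_fibers, Nat.card_eq_fintype_card]; simp
  let fib : Plane → ι := fun i => (g i).1
  have fib_inj : ∀ {i j}, fib i = fib j → i = j := fun e => g.injective (Subtype.ext e)
  have fib_surj : ∀ x, ∃ i, c x x = fib i := fun x =>
    ⟨g.symm ⟨c x x, x, rfl⟩, by simp [fib]⟩
  choose y hy using fun i => (g i).2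
  replace hy : ∀ i, c (y i) (y i) = fib i := hy
  have yne : ∀ {i j}, i ≠ j → c (y i) (y i) ≠ c (y j) (y j) := fun hij hc => by
    rw [hy, hy] at hc; exact hij (fib_inj hc)
  have hpt : ∀ i a, ∃ p, c p p = fib i ∧ (a = 0 → p = y i) ∧
      (a ≠ 0 → p ≠ y i ∧ c (y (i + J a)) p = c (y (i + J a)) (y i)) := by
    intro i a
    by_cases ha : a = 0
    · exact ⟨y i, hy i, fun _ => rfl, fun hne => (hne ha).elim⟩
    · obtain ⟨p, -, -, hp, -, -, e, -, -, hne, -⟩ := s.halves (y (i + J a)) (y i) (yne (f1 i a ha))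
      exact ⟨p, hp.trans (hy i), fun h0 => (ha h0).elim, fun _ => ⟨hne.symm, e⟩⟩
  choose P hP hP0 hP1 using hpt
  have Pinj : ∀ i a a', P i a = P i a' → a = a' := by
    intro i a a' he
    by_contra hne
    by_cases ha : a = 0
    · subst ha
      exact (hP1 i a' (Ne.symm hne)).1 (he.symm.trans (hP0 i 0 rfl))
    by_cases ha' : a' = 0
    · subst ha'
      exact (hP1 i a ha).1 (he.trans (hP0 i 0 rfl))
    have e2 := (hP1 i a' ha').2
    rw [← he] at e2
    exact s.skew _ _ _ _ (yne (f1 i a ha)) (yne (f1 i a' ha')) (yne (f1' i a a' hne))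
      ((hP i a).trans (hy i).symm) (hP1 i a ha).1 (hP1 i a ha).2 e2
  have fibne : ∀ {x i j}, c x x = fib j → i ≠ j → c x x ≠ c (y i) (y i) := fun hx hij hc => by
    rw [hx, hy] at hc; exact hij (fib_inj hc.symm)
  -- By skewness, the fiber `i + J a` is the only one whose matching joins `P i a` to `y i`.
  have H0 : ∀ i j a x, i ≠ j → c x x = fib j →
      (c x (P i a) = c x (y i) ↔ form (i + j) a = 0) := by
    intro i j a x hij hx
    by_cases ha : a = 0
    · subst ha
      rw [hP0 i 0 rfl]
      simp [form]
    rw [f2 i j a hij ha]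
    constructor
    · intro he
      by_contra hne
      exact s.skew _ _ _ _ (fibne hx hij) (yne (f1 i a ha))
        (fun hc => hne (fib_inj ((hy _).symm.trans (hc.symm.trans hx))))
        ((hP i a).trans (hy i).symm) (hP1 i a ha).1 he (hP1 i a ha).2
    · rintro rfl
      have hb := s.block _ _ (yne (f1 i a ha))
      exact hb _ x _ _ rfl (hx.trans (hy _).symm) ((hP i a).trans (hy i).symm) rfl (hP1 i a ha).2
  have H : ∀ i j a b x, i ≠ j → c x x = fib j →
      (c x (P i a) = c x (P i b) ↔ form (i + j) (a + b) = 0) := by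
    intro i j a b x hij hx
    have ha := H0 i j a x hij hx
    have hb := H0 i j b x hij hx
    rw [form_add]
    by_cases ka : form (i + j) a = 0 <;> by_cases kb : form (i + j) b = 0
    · rw [ha.2 ka, hb.2 kb, ka, kb]; simp
    · rw [ha.2 ka]
      exact ⟨fun e => (kb (hb.1 e.symm)).elim, fun e => (f4 _ _ ka kb e).elim⟩
    · rw [hb.2 kb]
      exact ⟨fun e => (ka (ha.1 e)).elim, fun e => (f4 _ _ kb ka (by rw [add_comm, e])).elim⟩
    · refine ⟨fun _ => f3 _ _ ka kb, fun _ => ?_⟩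
      exact s.eq_of_ne h (fibne hx hij) rfl rfl ((hP i a).trans (hy i).symm)
        ((hP i b).trans (hy i).symm) (fun e => ka (ha.1 e)) (fun e => kb (hb.1 e))
  -- The base points may be arbitrary: the colour of `(y i, y j)` serves as the value zero of the
  -- form in its interspace.
  have K1 : ∀ i j a b, i ≠ j →
      (c (P i a) (P j b) = c (y i) (y j) ↔ form (i + j) (a + b) = 0) := by
    intro i j a b hij
    have e1 : c (P i a) (P j b) = c (P i a) (y j) ↔ form (i + j) b = 0 := by
      rw [add_comm i j]; exact H0 j i b _ hij.symm (hP i a)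
    have e2 : c (P i a) (y j) = c (y i) (y j) ↔ form (i + j) a = 0 := by
      rw [← H0 i j a (y j) hij (hy j)]
      exact ⟨fun e => h.transp e, fun e => h.transp e⟩
    rw [form_add]
    by_cases ka : form (i + j) a = 0 <;> by_cases kb : form (i + j) b = 0
    · rw [e1.2 kb, e2.2 ka, ka, kb]; simp
    · rw [← e2.2 ka]
      exact ⟨fun e => (kb (e1.1 e)).elim, fun e => (f4 _ _ ka kb e).elim⟩
    · rw [e1.2 kb]
      exact ⟨fun e => (ka (e2.1 e)).elim, fun e => (f4 _ _ kb ka (by rw [add_comm, e])).elim⟩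
    · refine ⟨fun _ => f3 _ _ ka kb, fun _ => ?_⟩
      have hPi : ∀ a, c (P i a) (P i a) = c (y i) (y i) := fun a => (hP i a).trans (hy i).symm
      refine s.eq_of_ne h (x := P i a) (y := y j) (by rw [hPi]; exact yne hij) rfl (hPi a).symm
        ((hP j b).trans (hy j).symm) rfl (fun e => kb (e1.1 e)) (fun e => ka (e2.1 e.symm))
  have K1' : ∀ i j a b a' b', i ≠ j → (c (P i a) (P j b) = c (P i a') (P j b') ↔
      form (i + j) (a + b) = form (i + j) (a' + b')) := by
    intro i j a b a' b' hij
    have e1 := K1 i j a b hij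
    have e2 := K1 i j a' b' hij
    by_cases k1 : form (i + j) (a + b) = 0 <;> by_cases k2 : form (i + j) (a' + b') = 0
    · rw [e1.2 k1, e2.2 k2, k1, k2]; simp
    · rw [e1.2 k1, k1]
      exact ⟨fun e => (k2 (e2.1 e.symm)).elim, fun e => (k2 e.symm).elim⟩
    · rw [e2.2 k2, k2]
      exact ⟨fun e => (k1 (e1.1 e)).elim, fun e => (k1 e).elim⟩
    · refine ⟨fun _ => f9 _ _ k1 k2, fun _ => ?_⟩
      exact s.eq_of_ne h (yne hij) ((hP i a).trans (hy i).symm) ((hP i a').trans (hy i).symm)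
        ((hP j b).trans (hy j).symm) ((hP j b').trans (hy j).symm) (fun e => k1 (e1.1 e))
        (fun e => k2 (e2.1 e))
  have Psurj : ∀ x, ∃ i a, P i a = x := by
    intro x
    obtain ⟨i, hi⟩ := fib_surj x
    obtain ⟨y1, y2, y3, -, -, -, -, -, -, -, -, -, -, -, -, hall⟩ :=
      s.halves (y (i + 1)) (y i) (yne (f7 i 1 (by decide)).symm)
    have hmem : ∀ w, c w w = fib i → w ∈ ({y i, y1, y2, y3} : Finset V) := by
      intro w hw
      have := hall w (hw.trans (hy i).symm)
      simpa using this
    have himg : Finset.univ.image (P i) = {y i, y1, y2, y3} := by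
      apply Finset.eq_of_subset_of_card_le
      · intro w hw
        obtain ⟨a, -, rfl⟩ := Finset.mem_image.1 hw
        exact hmem _ (hP i a)
      · rw [Finset.card_image_of_injective _ (fun a a' => Pinj i a a')]
        exact Finset.card_le_four.trans (by simp)
    have := hmem x hi
    rw [← himg] at this
    obtain ⟨a, -, ha⟩ := Finset.mem_image.1 this
    exact ⟨i, a, ha⟩
  -- The colour of a pair inside a fiber tells which outside fibers match the pair, hence which
  -- forms vanish on `a + b`, and this determines `a + b`.
  have K2 : ∀ i a b a' b', c (P i a) (P i b) = c (P i a') (P i b') → a + b = a' + b' := by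
    intro i a b a' b' he
    apply f5
    intro k hk
    obtain ⟨e, h1, h2, h3, h4, h5, h6, h7⟩ := h.exists_equiv he
    have e1 := H i (i + k) a b (y (i + k)) (f7 i k hk) (hy _)
    have e2 := H i (i + k) a' b' (e (y (i + k))) (f7 i k hk) (by rw [h7, hy])
    rw [f8] at e1 e2
    rw [← e1, ← e2, h4, h6]
  have K2' : ∀ i a b a' b', c (P i a) (P i b) = c (P i a') (P i b') ↔ a + b = a' + b' := by
    refine fun i a b a' b' => ⟨K2 i a b a' b', fun hab => ?_⟩
    obtain ⟨t, ht⟩ := h.exists_right ((hP i a).trans (hP i a').symm) (P i b)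
    obtain ⟨j, b'', rfl⟩ := Psurj t
    obtain rfl : i = j := fib_inj ((hP i b).symm.trans ((h.snd_eq ht).trans (hP j b'')))
    have := K2 _ _ _ _ _ ht
    rw [hab] at this
    rw [f6 _ _ _ this]
    exact ht
  refine ⟨fun p => P p.1 p.2, ⟨?_, ?_⟩, ?_⟩
  · rintro ⟨i, a⟩ ⟨j, b⟩ he
    change P i a = P j b at he
    obtain rfl : i = j := fib_inj ((hP i a).symm.trans (by rw [he, hP]))
    rw [Pinj i a b he]
  · intro x
    obtain ⟨i, a, rfl⟩ := Psurj x
    exact ⟨(i, a), rfl⟩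
  · rintro ⟨i, a⟩ ⟨j, b⟩ ⟨i', a'⟩ ⟨j', b'⟩
    have hleft : c (P i a) (P j b) = c (P i' a') (P j' b') → i = i' ∧ j = j' := fun he =>
      ⟨fib_inj ((hP i a).symm.trans ((h.fst_eq he).trans (hP i' a'))),
        fib_inj ((hP j b).symm.trans ((h.snd_eq he).trans (hP j' b')))⟩
    have hright : col (i, a) (j, b) = col (i', a') (j', b') → i = i' ∧ j = j' := fun he =>
      ⟨congrArg (·.1) he, congrArg (·.2.1) he⟩
    by_cases hii : i = i' ∧ j = j'
    · obtain ⟨rfl, rfl⟩ := hii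
      by_cases hij : i = j
      · subst hij
        rw [K2', col_self, col_self]
        simp
      · rw [K1' _ _ _ _ _ _ hij, col_of_ne hij, col_of_ne hij]
        simp
    · exact ⟨fun he => (hii (hleft he)).elim, fun he => (hii (hright he)).elim⟩

theorem combinatoriallyIsomorphic [Finite V] {C : CoherentConfiguration V}
    (s : IsSkewK4 C.color) : C.CombinatoriallyIsomorphic config := by
  obtain ⟨P, hP, hcol⟩ := s.exists_coordinates C.twin_color
  let e : V ≃ Fin 16 := (Equiv.ofBijective P hP).symm.trans coord.symm
  refine ⟨e, CoherentConfiguration.isCombinatorialIso_ofColor e fun x y u v => ?_⟩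
  obtain ⟨p, rfl⟩ := hP.2 x
  obtain ⟨q, rfl⟩ := hP.2 y
  obtain ⟨p', rfl⟩ := hP.2 u
  obtain ⟨q', rfl⟩ := hP.2 v
  have he : ∀ p, coord (e (P p)) = p := fun p => by
    simp only [e, Equiv.trans_apply, Equiv.apply_symm_apply]
    exact (Equiv.ofBijective P hP).symm_apply_apply p
  rw [hcol]
  simp only [finCol, he]

end Twin.IsSkewK4

/-! ### From fibers and matchings to colours -/

namespace CoherentConfiguration

variable {V : Type u} {C : CoherentConfiguration V}

theorem mem_fibers_iff {X : Set V} :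
    X ∈ C.fibers ↔ ∃ x, X = {y | C.color y y = C.color x x} := by
  constructor
  · intro hX
    obtain ⟨⟨x, x'⟩, hxx, hx⟩ := C.rel_nonempty ⟨_, hX⟩
    obtain rfl : x = x' := hxx
    have h1 := (C.mem_iff_color ⟨_, hX⟩ x x).1 ⟨rfl, hx⟩
    refine ⟨x, Set.ext fun y => ?_⟩
    change y ∈ X ↔ C.color y y = C.color x x
    rw [h1, ← C.mem_iff_color]
    exact ⟨fun hy => ⟨rfl, hy⟩, fun hy => hy.2⟩
  · rintro ⟨x, rfl⟩
    change {p : V × V | p.1 = p.2 ∧ p.1 ∈ {y | C.color y y = C.color x x}} ∈ C.rels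
    convert (C.color x x).2 using 1
    ext ⟨y, z⟩
    rw [C.mem_iff_color]
    constructor
    · rintro ⟨h1, h2⟩
      obtain rfl : y = z := h1
      exact h2
    · intro h1
      obtain rfl := C.color_loop h1.symm
      exact ⟨rfl, h1⟩

theorem HasMaxFiberSize.smallFibers (h : C.HasMaxFiberSize 4) : Twin.SmallFibers C.color :=
  fun x => h.2 ⟨_, mem_fibers_iff.2 ⟨x, rfl⟩, rfl⟩

theorem Is2K22With.color_eq_iff {X Y A B : Set V} (w : C.Is2K22With X Y A B) {x x' y y' : V}
    (hx : x ∈ X) (hx' : x' ∈ X) (hy : y ∈ Y) (hy' : y' ∈ Y) :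
    C.color x y = C.color x' y' ↔ ((x ∈ A ↔ y ∈ B) ↔ (x' ∈ A ↔ y' ∈ B)) := by
  obtain ⟨-, -, -, -, -, -, hint⟩ := w
  have h1 : A ×ˢ B ∪ (X \ A) ×ˢ (Y \ B) ∈ C.rels := (hint.ge (Or.inl rfl)).1
  have h2 : A ×ˢ (Y \ B) ∪ (X \ A) ×ˢ B ∈ C.rels := (hint.ge (Or.inr rfl)).1
  have m1 : ∀ x ∈ X, ∀ y ∈ Y, ((x ∈ A ↔ y ∈ B) ↔ C.color x y = ⟨_, h1⟩) := by
    intro x hx y hy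
    rw [← C.mem_iff_color]
    simp only [Set.mem_union, Set.mem_prod, Set.mem_sdiff, hx, hy, true_and]
    tauto
  have m2 : ∀ x ∈ X, ∀ y ∈ Y, (¬ (x ∈ A ↔ y ∈ B) ↔ C.color x y = ⟨_, h2⟩) := by
    intro x hx y hy
    rw [← C.mem_iff_color]
    simp only [Set.mem_union, Set.mem_prod, Set.mem_sdiff, hx, hy, true_and]
    tauto
  by_cases k : (x ∈ A ↔ y ∈ B) <;> by_cases k' : (x' ∈ A ↔ y' ∈ B)
  · rw [(m1 x hx y hy).1 k, (m1 x' hx' y' hy').1 k']; simp [k, k']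
  · refine ⟨fun e => ?_, fun e => (k' (e.1 k)).elim⟩
    exact (k' ((m1 x' hx' y' hy').2 (e ▸ (m1 x hx y hy).1 k))).elim
  · refine ⟨fun e => ?_, fun e => (k (e.2 k')).elim⟩
    exact (k ((m1 x hx y hy).2 (e ▸ (m1 x' hx' y' hy').1 k'))).elim
  · rw [(m2 x hx y hy).1 k, (m2 x' hx' y' hy').1 k']; simp [k, k']

theorem eq_pair_of_ncard_eq_two {S : Set V} (hS : S.ncard = 2) {x y : V} (hx : x ∈ S)
    (hy : y ∈ S) (hxy : x ≠ y) : S = {x, y} := by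
  obtain ⟨a, b, -, rfl⟩ := Set.ncard_eq_two.1 hS
  rcases hx with rfl | rfl <;> rcases hy with rfl | rfl
  · exact (hxy rfl).elim
  · rfl
  · exact Set.pair_comm _ _
  · exact (hxy rfl).elim

/-- Two interspaces of type `2K_{2,2}` that match a common pair determine the same matching. -/
theorem directlyConnectedAt_of_common {X Z Y A B A' B' : Set V} (w : C.Is2K22With X Y A B)
    (w' : C.Is2K22With Z Y A' B') {y y' : V} (hy : y ∈ Y) (hy' : y' ∈ Y) (hne : y' ≠ y)
    (h : y ∈ B ↔ y' ∈ B) (h' : y ∈ B' ↔ y' ∈ B') : C.DirectlyConnectedAt X Z Y := by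
  -- The pair `{y, y'}` is one half of both partitions of `Y`, so the other halves agree too.
  have hcases : B' = B ∨ B' = Y \ B := by
    have hBY := w.2.1
    have hBY' := w'.2.1
    by_cases k : y ∈ B <;> by_cases k' : y ∈ B'
    · left
      rw [eq_pair_of_ncard_eq_two w.2.2.2.2.1 k (h.1 k) hne.symm,
        eq_pair_of_ncard_eq_two w'.2.2.2.2.1 k' (h'.1 k') hne.symm]
    · right
      rw [eq_pair_of_ncard_eq_two w.2.2.2.2.1 k (h.1 k) hne.symm,
        ← eq_pair_of_ncard_eq_two w'.2.2.2.2.2.1 ⟨hy, k'⟩ ⟨hy', fun t => k' (h'.2 t)⟩ hne.symm,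
        Set.sdiff_sdiff_cancel_left hBY']
    · right
      rw [eq_pair_of_ncard_eq_two w.2.2.2.2.2.1 ⟨hy, k⟩ ⟨hy', fun t => k (h.2 t)⟩ hne.symm,
        eq_pair_of_ncard_eq_two w'.2.2.2.2.1 k' (h'.1 k') hne.symm]
    · left
      rw [← Set.sdiff_sdiff_cancel_left hBY', ← Set.sdiff_sdiff_cancel_left hBY,
        eq_pair_of_ncard_eq_two w.2.2.2.2.2.1 ⟨hy, k⟩ ⟨hy', fun t => k (h.2 t)⟩ hne.symm,
        eq_pair_of_ncard_eq_two w'.2.2.2.2.2.1 ⟨hy, k'⟩ ⟨hy', fun t => k' (h'.2 t)⟩ hne.symm]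
  refine ⟨_, ⟨A, B, w, rfl⟩, A', B', w', ?_⟩
  ext p
  rcases hcases with rfl | rfl
  · rfl
  · simp only [Set.sdiff_sdiff_cancel_left w.2.1, Set.mem_ofPred_eq]
    rw [or_comm]

theorem SkewConnected.isSkewK4 [Finite V] (hC : C.SkewConnected) (hK : C.FiberGraphIsK4) :
    Twin.IsSkewK4 C.color := by
  obtain ⟨g⟩ := hK
  let F : V → Set V := fun x => {y | C.color y y = C.color x x}
  have hF : ∀ x, F x ∈ C.fibers := fun x => mem_fibers_iff.2 ⟨x, rfl⟩
  have hself : ∀ x, x ∈ F x := fun x => rfl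
  have hFne : ∀ {x y}, C.color x x ≠ C.color y y → F x ≠ F y := by
    intro x y hxy he
    exact hxy (show x ∈ F y from he ▸ hself x)
  have htype : ∀ {x y}, C.color x x ≠ C.color y y → ∃ A B, C.Is2K22With (F x) (F y) A B := by
    intro x y hxy
    have hne := hFne hxy
    have hadj : C.fiberGraph.Adj ⟨F x, hF x⟩ ⟨F y, hF y⟩ := by
      rw [← g.map_adj_iff, SimpleGraph.top_adj]
      intro he
      exact hne (congrArg Subtype.val (g.injective he))
    exact hC.irredundant.interspace_type _ (hF x) _ (hF y) hne hadj.2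
  refine ⟨?_, ?_, ?_, ?_⟩
  · have h1 : C.fibers = (fun i => {y | C.color y y = i}) '' {i | ∃ x, C.color x x = i} := by
      ext X
      rw [mem_fibers_iff]
      constructor
      · rintro ⟨x, rfl⟩
        exact ⟨_, ⟨x, rfl⟩, rfl⟩
      · rintro ⟨_, ⟨x, rfl⟩, rfl⟩
        exact ⟨x, rfl⟩
    have h2 : C.fibers.ncard = 4 := by
      rw [← Nat.card_coe_set_eq, Nat.card_congr g.toEquiv]
      simp
    rw [h1, Set.InjOn.ncard_image] at h2
    · exact h2
    · rintro _ ⟨x, rfl⟩ j - he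
      have : x ∈ {y | C.color y y = j} := (Set.ext_iff.1 he x).1 rfl
      exact this
  · intro x y hxy a a' b b' ha ha' hb hb' hc
    obtain ⟨A, B, w⟩ := htype hxy
    rw [w.color_eq_iff ha ha hb hb'] at hc
    rw [w.color_eq_iff ha' ha' hb hb']
    tauto
  · intro x y hxy
    obtain ⟨A, B, w⟩ := htype hxy
    -- Here `S` is the half containing `y`, which may be `B` or its complement.
    have main : ∀ S S' : Set V, S.ncard = 2 → S'.ncard = 2 → S ⊆ F y → S' ⊆ F y →
        (∀ t ∈ F y, t ∈ S ↔ t ∉ S') → y ∈ S → (∀ t ∈ F y, ∀ t' ∈ F y,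
          (C.color x t = C.color x t' ↔ (t ∈ S ↔ t' ∈ S))) →
        ∃ y1 y2 y3, C.color y1 y1 = C.color y y ∧ C.color y2 y2 = C.color y y ∧
          C.color y3 y3 = C.color y y ∧ C.color x y1 = C.color x y ∧
          C.color x y3 = C.color x y2 ∧ C.color x y2 ≠ C.color x y ∧ y ≠ y1 ∧ y ≠ y2 ∧ y ≠ y3 ∧
          y1 ≠ y2 ∧ y1 ≠ y3 ∧ y2 ≠ y3 ∧
          ∀ w, C.color w w = C.color y y → w = y ∨ w = y1 ∨ w = y2 ∨ w = y3 := by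
      intro S S' hS hS' hSY hSY' hcompl hyS hcol
      obtain ⟨y1, hy1, hne1⟩ := Set.exists_ne_of_one_lt_ncard (by omega : 1 < S.ncard) y
      obtain ⟨y2, y3, hne2, rfl⟩ := Set.ncard_eq_two.1 hS'
      have hSe := eq_pair_of_ncard_eq_two hS hyS hy1 hne1.symm
      have m2 : y2 ∈ F y := hSY' (Or.inl rfl)
      have m3 : y3 ∈ F y := hSY' (Or.inr rfl)
      have k2 : y2 ∉ S := fun h => (hcompl _ m2).1 h (Or.inl rfl)
      have k3 : y3 ∉ S := fun h => (hcompl _ m3).1 h (Or.inr rfl)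
      refine ⟨y1, y2, y3, hSY hy1, m2, m3, ?_, ?_, ?_, hne1.symm, ?_, ?_, ?_, ?_, hne2, ?_⟩
      · rw [hcol _ (hSY hy1) _ (hself y)]; tauto
      · rw [hcol _ m3 _ m2]; tauto
      · rw [Ne, hcol _ m2 _ (hself y)]; tauto
      · rintro rfl; exact k2 hyS
      · rintro rfl; exact k3 hyS
      · rintro rfl; exact k2 hy1
      · rintro rfl; exact k3 hy1
      · intro t ht
        by_cases htS : t ∈ S
        · rw [hSe] at htS
          rcases htS with rfl | rfl
          · exact Or.inl rfl
          · exact Or.inr (Or.inl rfl)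
        · have : t ∈ ({y2, y3} : Set V) := by
            by_contra hc
            exact htS ((hcompl t ht).2 hc)
          rcases this with rfl | rfl
          · exact Or.inr (Or.inr (Or.inl rfl))
          · exact Or.inr (Or.inr (Or.inr rfl))
    have hcolor : ∀ t ∈ F y, ∀ t' ∈ F y,
        (C.color x t = C.color x t' ↔ (t ∈ B ↔ t' ∈ B)) := by
      intro t ht t' ht'
      rw [w.color_eq_iff (hself x) (hself x) ht ht']
      tauto
    by_cases hyB : y ∈ B
    · exact main B (F y \ B) w.2.2.2.2.1 w.2.2.2.2.2.1 w.2.1 Set.sdiff_subset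
        (fun t ht => by simp [ht]) hyB hcolor
    · refine main (F y \ B) B w.2.2.2.2.2.1 w.2.2.2.2.1 Set.sdiff_subset w.2.1
        (fun t ht => by simp [ht]) ⟨hself y, hyB⟩ fun t ht t' ht' => ?_
      rw [hcolor t ht t' ht']
      simp only [Set.mem_sdiff, ht, ht', true_and]
      tauto
  · intro x x' y y' hx hx' hxx hy' hne e e'
    obtain ⟨A, B, w⟩ := htype hx
    obtain ⟨A', B', w'⟩ := htype hx'
    rw [w.color_eq_iff (hself x) (hself x) hy' (hself y)] at e
    rw [w'.color_eq_iff (hself x') (hself x') hy' (hself y)] at e'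
    exact hC.skewed _ (hF x) _ (hF y) _ (hF x') (hFne hx) (hFne hx') (hFne hxx)
      (directlyConnectedAt_of_common w w' (hself y) hy' hne (by tauto) (by tauto))

end CoherentConfiguration

/-! ### The model is skew-connected with complete fiber graph -/

namespace SkewK4

open CoherentConfiguration

theorem config_color_eq_iff {x y u v : Fin 16} :
    config.color x y = config.color u v ↔ finCol x y = finCol u v :=
  ofColor_color_eq_iff

/-- The fiber with index `i`. -/
def fiber (i : Plane) : Set (Fin 16) := {x | (coord x).1 = i}

/-- One half of the fiber `i` with respect to the fiber `j`. -/
def half (i j : Plane) : Set (Fin 16) := {x | (coord x).1 = i ∧ form (i + j) (coord x).2 = 0}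

theorem finCol_loop_eq (x : Fin 16) : finCol x x = ((coord x).1, (coord x).1, 0) := by
  have h : ∀ a : Plane, a + a = 0 := by decide
  simp only [finCol, col, if_true, h]

theorem mem_fibers_config {X : Set (Fin 16)} : X ∈ config.fibers ↔ ∃ i, X = fiber i := by
  have h : ∀ x, {y | config.color y y = config.color x x} = fiber (coord x).1 := by
    intro x
    ext y
    change config.color y y = config.color x x ↔ (coord y).1 = (coord x).1
    rw [config_color_eq_iff, finCol_loop_eq, finCol_loop_eq]
    simp
  rw [mem_fibers_iff]
  constructor
  · rintro ⟨x, rfl⟩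
    exact ⟨_, h x⟩
  · rintro ⟨i, rfl⟩
    exact ⟨coord.symm (i, 0), by rw [h]; simp⟩

theorem ncard_setOf_coord (p : Plane × Plane → Prop) [DecidablePred p] :
    {x | p (coord x)}.ncard = (Finset.univ.filter p).card := by
  have h : {x | p (coord x)} = coord.symm '' ((Finset.univ.filter p : Finset _) : Set _) := by
    ext x
    simp
  rw [h, Set.ncard_image_of_injective _ coord.symm.injective, Set.ncard_coe_finset]

theorem ncard_fiber (i : Plane) : (fiber i).ncard = 4 := by
  rw [fiber, ncard_setOf_coord fun p => p.1 = i]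
  revert i; decide

theorem ncard_half {i j : Plane} (hij : i ≠ j) : (half i j).ncard = 2 := by
  rw [half, ncard_setOf_coord fun p => p.1 = i ∧ form (i + j) p.2 = 0]
  revert i j; decide

theorem ncard_diff_half {i j : Plane} (hij : i ≠ j) : (fiber i \ half i j).ncard = 2 := by
  rw [Set.ncard_sdiff (fun x hx => hx.1), ncard_fiber, ncard_half hij]

theorem fiber_nonempty (i : Plane) : (fiber i).Nonempty := ⟨coord.symm (i, 0), by simp [fiber]⟩

theorem fiber_injective : Function.Injective fiber := by
  intro i j h
  obtain ⟨x, hx⟩ := fiber_nonempty i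
  have hx' : x ∈ fiber j := h ▸ hx
  exact (show (coord x).1 = i from hx).symm.trans hx'

theorem finCol_eq_iff {i j : Plane} (hij : i ≠ j) (x y : Fin 16) (m : ZMod 2) :
    finCol x y = (i, j, (m, 0)) ↔ x ∈ fiber i ∧ y ∈ fiber j ∧
      form (i + j) (coord x).2 + form (i + j) (coord y).2 = m := by
  obtain ⟨⟨i', a⟩, rfl⟩ := coord.symm.surjective x
  obtain ⟨⟨j', b⟩, rfl⟩ := coord.symm.surjective y
  simp only [finCol, Equiv.apply_symm_apply, fiber, Set.mem_ofPred_eq, ← form_add]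
  constructor
  · intro h
    obtain rfl : i' = i := congrArg (·.1) h
    obtain rfl : j' = j := congrArg (·.2.1) h
    rw [col_of_ne hij] at h
    exact ⟨rfl, rfl, congrArg (·.2.2.1) h⟩
  · rintro ⟨rfl, rfl, rfl⟩
    exact col_of_ne hij a b

theorem colorClass_mem {i j : Plane} (hij : i ≠ j) (m : ZMod 2) :
    {p : Fin 16 × Fin 16 | finCol p.1 p.2 = (i, j, (m, 0))} ∈ config.rels := by
  have h2 : ∀ (k : Plane) (m : ZMod 2), k ≠ 0 → ∃ t, form k t = m := by decide
  have h3 : ∀ i j : Plane, i ≠ j → i + j ≠ 0 := by decide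
  obtain ⟨t, ht⟩ := h2 (i + j) m (h3 i j hij)
  refine ⟨coord.symm (i, 0), coord.symm (j, t), ?_⟩
  have : finCol (coord.symm (i, 0)) (coord.symm (j, t)) = (i, j, (m, 0)) := by
    rw [finCol, Equiv.apply_symm_apply, Equiv.apply_symm_apply, col_of_ne hij, zero_add, ht]
  rw [this]

/-- The form is additive, so the interspace colour says whether the two points lie on corresponding
sides of the kernels of `form (i + j)`. -/
theorem is2K22With_config {i j : Plane} (hij : i ≠ j) :
    config.Is2K22With (fiber i) (fiber j) (half i j) (half j i) := by
  refine ⟨fun x hx => hx.1, fun x hx => hx.1, ncard_half hij, ncard_diff_half hij,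
    ncard_half hij.symm, ncard_diff_half hij.symm, ?_⟩
  have d1 : ∀ u w : ZMod 2, u + w = 0 ↔ (u = 0 ∧ w = 0) ∨ (u ≠ 0 ∧ w ≠ 0) := by decide
  have d2 : ∀ u w : ZMod 2, u + w = 1 ↔ (u = 0 ∧ w ≠ 0) ∨ (u ≠ 0 ∧ w = 0) := by decide
  have e1 : half i j ×ˢ half j i ∪ (fiber i \ half i j) ×ˢ (fiber j \ half j i) =
      {p : Fin 16 × Fin 16 | finCol p.1 p.2 = (i, j, (0, 0))} := by
    ext ⟨x, y⟩
    rw [Set.mem_ofPred_eq, finCol_eq_iff hij, d1, half, half, add_comm j i]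
    simp only [Set.mem_union, Set.mem_prod, Set.mem_sdiff, fiber, Set.mem_ofPred_eq]
    tauto
  have e2 : half i j ×ˢ (fiber j \ half j i) ∪ (fiber i \ half i j) ×ˢ half j i =
      {p : Fin 16 × Fin 16 | finCol p.1 p.2 = (i, j, (1, 0))} := by
    ext ⟨x, y⟩
    rw [Set.mem_ofPred_eq, finCol_eq_iff hij, d2, half, half, add_comm j i]
    simp only [Set.mem_union, Set.mem_prod, Set.mem_sdiff, fiber, Set.mem_ofPred_eq]
    tauto
  rw [e1, e2]
  ext R
  constructor
  · rintro ⟨⟨x, y, rfl⟩, hsub⟩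
    obtain ⟨hx, hy⟩ : x ∈ fiber i ∧ y ∈ fiber j := hsub (a := (x, y)) rfl
    have h := (finCol_eq_iff hij x y _).2 ⟨hx, hy, rfl⟩
    rw [h]
    have h01 : ∀ u : ZMod 2, u = 0 ∨ u = 1 := by decide
    rcases h01 (form (i + j) (coord x).2 + form (i + j) (coord y).2) with k | k <;> rw [k]
    · exact Or.inl rfl
    · exact Or.inr rfl
  · rintro (rfl | rfl)
    · exact ⟨colorClass_mem hij 0, fun p hp =>
        ⟨((finCol_eq_iff hij _ _ _).1 hp).1, ((finCol_eq_iff hij _ _ _).1 hp).2.1⟩⟩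
    · exact ⟨colorClass_mem hij 1, fun p hp =>
        ⟨((finCol_eq_iff hij _ _ _).1 hp).1, ((finCol_eq_iff hij _ _ _).1 hp).2.1⟩⟩

theorem not_isUniform {i j : Plane} (hij : i ≠ j) : ¬ config.IsUniform (fiber i) (fiber j) := by
  intro hu
  have h := (is2K22With_config hij).2.2.2.2.2.2.le ⟨hu, subset_rfl⟩
  have hmem : ∀ a b : Plane, (coord.symm (i, a), coord.symm (j, b)) ∈ fiber i ×ˢ fiber j :=
    fun a b => by simp [fiber]
  have d : ∀ i j : Plane, i ≠ j → ∃ t, form (i + j) t ≠ 0 := by decide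
  obtain ⟨t, ht⟩ := d i j hij
  have hf0 : form (i + j) 0 = 0 := by simp [form]
  rcases h with h | h
  · have := hmem 0 t
    rw [h] at this
    simp [half, add_comm j i, hf0, ht] at this
  · have := hmem 0 0
    rw [h] at this
    simp [half, add_comm j i, hf0] at this

theorem hasMaxFiberSize : config.HasMaxFiberSize 4 := by
  refine ⟨⟨fiber 0, mem_fibers_config.2 ⟨0, rfl⟩, ncard_fiber 0⟩, ?_⟩
  rintro _ ⟨X, hX, rfl⟩
  obtain ⟨i, rfl⟩ := mem_fibers_config.1 hX
  exact (ncard_fiber i).le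

theorem fiberGraphIsK4 : config.FiberGraphIsK4 := by
  let e : Plane ≃ config.fibers := Equiv.ofBijective
    (fun i => ⟨fiber i, mem_fibers_config.2 ⟨i, rfl⟩⟩)
    ⟨fun i j h => fiber_injective (congrArg Subtype.val h), fun X => by
      obtain ⟨i, hi⟩ := mem_fibers_config.1 X.2
      exact ⟨i, Subtype.ext hi.symm⟩⟩
  have hcard : Fintype.card Plane = 4 := by simp
  refine ⟨⟨e.symm.trans (Fintype.equivFinOfCardEq hcard), fun {X Y} => ?_⟩⟩
  obtain ⟨i, rfl⟩ := e.surjective X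
  obtain ⟨j, rfl⟩ := e.surjective Y
  simp only [Equiv.trans_apply, Equiv.symm_apply_apply, SimpleGraph.top_adj, ne_eq,
    EmbeddingLike.apply_eq_iff_eq]
  constructor
  · intro hij
    exact ⟨fun h => hij (e.injective h), not_isUniform hij⟩
  · rintro h rfl
    exact h.1 rfl

theorem irredundant : config.Irredundant where
  indecomposable := by
    rintro ⟨F, hF, ⟨x, X, hX, hx⟩, ⟨y, hy⟩, hunif⟩
    obtain ⟨i, rfl⟩ := mem_fibers_config.1 (hF hX)
    have hdisj : fiber (coord y).1 ⊆ (⋃₀ F)ᶜ := by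
      rintro z hz ⟨Z, hZ, hzZ⟩
      obtain ⟨k, rfl⟩ := mem_fibers_config.1 (hF hZ)
      apply hy
      refine ⟨fiber k, hZ, ?_⟩
      change (coord y).1 = k
      rw [← show (coord z).1 = k from hzZ]
      exact (show (coord z).1 = (coord y).1 from hz).symm
    refine not_isUniform ?_ (hunif _ (hF hX) _ (mem_fibers_config.2 ⟨(coord y).1, rfl⟩)
      (Set.subset_sUnion_of_mem hX) hdisj)
    rintro rfl
    exact hy ⟨_, hX, rfl⟩
  fiber_size := by
    intro X hX
    obtain ⟨i, rfl⟩ := mem_fibers_config.1 hX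
    exact ncard_fiber i
  interspace_type := by
    intro X hX Y hY hne _
    obtain ⟨i, rfl⟩ := mem_fibers_config.1 hX
    obtain ⟨j, rfl⟩ := mem_fibers_config.1 hY
    exact ⟨_, _, is2K22With_config fun h => hne (congrArg fiber h)⟩

/-- A pair matched from two other fibers has a difference killed by the forms of two independent
vectors, so its points coincide. -/
theorem skewConnected : config.SkewConnected where
  irredundant := irredundant
  skewed := by
    rintro X hX Y hY Z hZ hXY hZY hXZ ⟨M, ⟨A, B, w, rfl⟩, A', B', w', hM⟩
    obtain ⟨i, rfl⟩ := mem_fibers_config.1 hX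
    obtain ⟨j, rfl⟩ := mem_fibers_config.1 hY
    obtain ⟨k, rfl⟩ := mem_fibers_config.1 hZ
    obtain ⟨y, y', hne, hB⟩ := Set.ncard_eq_two.1 w.2.2.2.2.1
    have hyB : y ∈ B := hB ▸ Or.inl rfl
    have hyB' : y' ∈ B := hB ▸ Or.inr rfl
    have hy := w.2.1 hyB
    have hy' := w.2.1 hyB'
    have hmem := (Set.ext_iff.1 hM (y, y')).1 ⟨hne, Or.inl ⟨hyB, hyB'⟩⟩
    have hiff : y ∈ B' ↔ y' ∈ B' := by
      rcases hmem.2 with h | h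
      · exact ⟨fun _ => h.2, fun _ => h.1⟩
      · exact ⟨fun t => (h.1.2 t).elim, fun t => (h.2.2 t).elim⟩
    have key : ∀ l : Plane, l ≠ j → ∀ A B, config.Is2K22With (fiber l) (fiber j) A B →
        (y ∈ B ↔ y' ∈ B) →
        form (l + j) (coord y).2 = form (l + j) (coord y').2 := by
      intro l hl A B w h
      obtain ⟨x, hx⟩ := fiber_nonempty l
      have h1 := (w.color_eq_iff hx hx hy hy').2 (by tauto)
      rw [config_color_eq_iff, (finCol_eq_iff hl x y' _).2 ⟨hx, hy', rfl⟩] at h1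
      exact (add_left_cancel ((finCol_eq_iff hl x y _).1 h1).2.2)
    have k1 := key i (fun h => hXY (congrArg fiber h)) A B w (by simp [hyB, hyB'])
    have k2 := key k (fun h => hZY (congrArg fiber h)) A' B' w' hiff
    have d : ∀ i j k : Plane, i ≠ j → k ≠ j → i ≠ k → ∀ u, form (i + j) u = 0 →
        form (k + j) u = 0 → u = 0 := by decide
    have d2 : ∀ a b : Plane, a + b = 0 → a = b := by decide
    have d3 : ∀ a : ZMod 2, a + a = 0 := by decide
    have h0 := d i j k (fun h => hXY (congrArg fiber h)) (fun h => hZY (congrArg fiber h))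
      (fun h => hXZ (congrArg fiber h)) ((coord y).2 + (coord y').2)
      (by rw [form_add, k1, d3]) (by rw [form_add, k2, d3])
    apply hne
    apply coord.injective
    exact Prod.ext ((show (coord y).1 = j from hy).trans
      (show (coord y').1 = j from hy').symm) (d2 _ _ h0)

end SkewK4

/-! ### Conclusion -/

theorem CoherentConfiguration.isSkewK4_of_not_separable {V : Type u} [Finite V]
    {C : CoherentConfiguration V} (hcard : Nat.card V ≤ 16) (hmax : C.HasMaxFiberSize 4)
    (hsep : ¬ C.Separable) : Twin.IsSkewK4 C.color ∧ 16 ≤ Nat.card V := by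
  by_contra hcon
  apply hsep
  intro W _ D f hf
  by_cases hext : Extends C.color (fun u v => f.symm (D.color u v)) Set.univ
  · obtain ⟨φ, hφ⟩ := hext
    exact induced_of_color hf φ fun x y => hφ x y trivial trivial
  · exact (hcon (Twin.isSkewK4_of_not_extends hf.twin hmax.smallFibers hcard hext)).elim

theorem mainTheorem11 :
    (∀ (V : Type u) [Finite V] (C : CoherentConfiguration V),
      Nat.card V ≤ 15 → C.HasMaxFiberSize 4 → C.Separable) ∧
    (∃ T : CoherentConfiguration (Fin 16),
      T.HasMaxFiberSize 4 ∧ ¬ T.Separable ∧ T.SkewConnected ∧ T.FiberGraphIsK4 ∧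
      (∀ (V : Type u) [Finite V] (C : CoherentConfiguration V),
        Nat.card V = 16 → C.HasMaxFiberSize 4 → ¬ C.Separable →
          C.CombinatoriallyIsomorphic T) ∧
      (∀ (V : Type u) [Finite V] (C : CoherentConfiguration V),
        C.SkewConnected → C.FiberGraphIsK4 → C.CombinatoriallyIsomorphic T)) := by
  refine ⟨fun V _ C hcard hmax => ?_, SkewK4.config, SkewK4.hasMaxFiberSize,
    SkewK4.not_separable, SkewK4.skewConnected, SkewK4.fiberGraphIsK4,
    fun V _ C hcard hmax hsep => ?_, fun V _ C hC hK => ?_⟩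
  · by_contra hsep
    have := (CoherentConfiguration.isSkewK4_of_not_separable (by omega) hmax hsep).2
    omega
  · exact (CoherentConfiguration.isSkewK4_of_not_separable hcard.le hmax
      hsep).1.combinatoriallyIsomorphic
  · exact (hC.isSkewK4 hK).combinatoriallyIsomorphic
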